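/- Let $\mathcal H$ be a finite-dimensional complex Hilbert space and let $H_1,\dots,H_\Lambda:\mathbb R\to\mathcal B(\mathcal H)$ be smooth operator-valued functions of time; put $H(t)=\sum_{k=1}^{\Lambda}H_k(t)$. For a continuous $A:\mathbb R\to\mathcal B(\mathcal H)$ write $\exp_{\mathcal T}\big(\int_s^t A(r)\,dr\big)$ for the time-ordered exponential, i.e. the sum of the Dyson series $\sum_{n\ge0}D_n(t,s)$ with $D_0=I$ and $D_{n+1}(t,s)=\int_s^t A(r)D_n(r,s)\,dr$, and let $U(t,s)=\exp_{\mathcal T}\big(-i\int_s^t H(r)\,dr\big)$. Ordered products are $\prod_{k=1}^{n}A_k=A_1A_2\cdots A_n$ and $\prod_{k=n}^{1}A_k=A_n\cdots A_2A_1$. Let $M,m\in\mathbb N$, let $\alpha_1,\dots,\alpha_M\in\mathbb R$ and let $k_1,\dots,k_M\ge1$ be integers for which the time-independent multi-product formula of order $2m$ holds: for all self-adjoint operators $A_1,\dots,A_\Lambda$ on $\mathcal H$, $$e^{-i\Delta t\sum_{k}A_k}=\sum_{j=1}^{M}\alpha_j\Big(U_2(\Delta t/k_j)\Big)^{k_j}+O(\Delta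 t^{2m+1})\quad(\Delta t\to0^+),\qquad U_2(\delta)=\prod_{k=1}^{\Lambda}e^{-i\frac{\delta}{2}A_k}\prod_{k=\Lambda}^{1}e^{-i\frac{\delta}{2}A_k},$$ where the implied constant may depend on the operators $A_k$. Then for every $t\in\mathbb R$, as $\Delta t\to0^+$, $$U(t+\Delta t,t)=\sum_{j=1}^{M}\alpha_j\prod_{\ell=k_j-1}^{0}\widetilde U_2\Big(t+\tfrac{(\ell+1)\Delta t}{k_j},\,t+\tfrac{\ell\,\Delta t}{k_j}\Big)+O(\Delta t^{2m+1}),$$ where $\widetilde U_2$ is the second-order Huyghebaert–De Raedt step $$\widetilde U_2(t,s)=\prod_{k=1}^{\Lambda}\exp_{\mathcal T}\Big(-i\int_{s+\frac{t-s}{2}}^{t}H_k(r)\,dr\Big)\ \prod_{k=\Lambda}^{1}\exp_{\mathcal T}\Big(-i\int_{s}^{s+\frac{t-s}{2}}H_k(r)\,dr\Big).$$ -/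

import Mathlib

open Filter Topology Asymptotics
open scoped ContDiff

/-- The ordered product `∏_{k=1}^{n} A_k = A_1 A_2 ⋯ A_n`. -/
def prodAsc {R : Type*} [Monoid R] {n : ℕ} (A : Fin n → R) : R :=
  (List.ofFn A).prod

/-- The ordered product `∏_{k=n}^{1} A_k = A_n ⋯ A_2 A_1`. -/
def prodDesc {R : Type*} [Monoid R] {n : ℕ} (A : Fin n → R) : R :=
  (List.ofFn A).reverse.prod

/-- The terms of the Dyson series:
`dysonTerm A s n t = ∫_{s ≤ r₁ ≤ ⋯ ≤ rₙ ≤ t} A(rₙ) ⋯ A(r₁)`, as an iterated (oriented) integral. -/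
noncomputable def dysonTerm {R : Type*} [NormedRing R] [NormedAlgebra ℝ R]
    (A : ℝ → R) (s : ℝ) : ℕ → ℝ → R
  | 0 => fun _ => 1
  | n + 1 => fun t => ∫ r in s..t, A r * dysonTerm A s n r

/-- The time-ordered exponential `exp_𝒯 (∫_s^t A(r) dr)`, with later times to the left,
as the sum of its Dyson series. -/
noncomputable def timeOrderedExp {R : Type*} [NormedRing R] [NormedAlgebra ℝ R]
    (A : ℝ → R) (s t : ℝ) : R :=
  ∑' n : ℕ, dysonTerm A s n t

section DysonFacts

variable {R : Type*} [NormedRing R] [NormedAlgebra ℝ R]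

theorem dysonTerm_continuous {A : ℝ → R} (hA : Continuous A) (s : ℝ) (n : ℕ) :
    Continuous (dysonTerm A s n) := by
  induction n with
  | zero => exact continuous_const
  | succ n ih =>
    exact intervalIntegral.continuous_primitive
      (fun a b => (hA.mul ih).intervalIntegrable a b) s

theorem dysonTerm_hasDerivAt [CompleteSpace R] {A : ℝ → R} (hA : Continuous A) (s : ℝ) (n : ℕ)
    (t : ℝ) : HasDerivAt (dysonTerm A s (n + 1)) (A t * dysonTerm A s n t) t :=
  intervalIntegral.integral_hasDerivAt_right
    ((hA.mul (dysonTerm_continuous hA s n)).intervalIntegrable s t)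
    ((hA.mul (dysonTerm_continuous hA s n)).stronglyMeasurableAtFilter _ _)
    (hA.mul (dysonTerm_continuous hA s n)).continuousAt

theorem dysonTerm_norm_le {A : ℝ → R} (hA : Continuous A) (s ρ C : ℝ)
    (hC : ∀ r ∈ Metric.ball s ρ, ‖A r‖ ≤ C) (n : ℕ) :
    ∀ t ∈ Metric.ball s ρ,
      ‖dysonTerm A s n t‖ ≤ ‖(1 : R)‖ * ((C * |t - s|) ^ n / (n.factorial : ℝ)) := by
  induction n with
  | zero => intro t _; simp [dysonTerm]
  | succ n ih =>
    intro t ht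
    have hsub : ∀ r ∈ Set.uIoc s t, r ∈ Metric.ball s ρ := by
      intro r hr
      have hs : s ∈ Metric.ball s ρ := Metric.mem_ball_self (Metric.pos_of_mem_ball ht)
      exact ((convex_ball s ρ).ordConnected.uIcc_subset hs ht) (Set.uIoc_subset_uIcc hr)
    have h1 : ‖dysonTerm A s (n + 1) t‖ ≤
        ∫ r in Set.uIoc s t, ‖A r * dysonTerm A s n r‖ :=
      intervalIntegral.norm_integral_le_integral_norm_uIoc
    have hcont : Continuous fun r => A r * dysonTerm A s n r :=
      hA.mul (dysonTerm_continuous hA s n)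
    have h2 : ∫ r in Set.uIoc s t, ‖A r * dysonTerm A s n r‖ ≤
        ∫ r in Set.uIoc s t, (C * ‖(1 : R)‖ * C ^ n / (n.factorial : ℝ)) * |r - s| ^ n := by
      refine MeasureTheory.setIntegral_mono_on ?_ ?_ measurableSet_uIoc ?_
      · exact (hcont.norm.integrableOn_uIcc).mono_set Set.uIoc_subset_uIcc
      · have hc : Continuous fun r : ℝ =>
            (C * ‖(1 : R)‖ * C ^ n / (n.factorial : ℝ)) * |r - s| ^ n := by fun_prop
        exact hc.integrableOn_uIcc.mono_set Set.uIoc_subset_uIcc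
      · intro r hr
        have hCr := hC r (hsub r hr)
        calc ‖A r * dysonTerm A s n r‖ ≤ ‖A r‖ * ‖dysonTerm A s n r‖ := norm_mul_le _ _
          _ ≤ C * (‖(1 : R)‖ * ((C * |r - s|) ^ n / (n.factorial : ℝ))) :=
              mul_le_mul hCr (ih r (hsub r hr)) (norm_nonneg _) ((norm_nonneg _).trans hCr)
          _ = _ := by rw [mul_pow]; ring
    refine (h1.trans h2).trans (le_of_eq ?_)
    rw [MeasureTheory.integral_const_mul, integral_pow_abs_sub_uIoc, Nat.factorial_succ, mul_pow]
    push_cast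
    field_simp
    ring

/-- The Dyson series converges. -/
theorem dysonTerm_summable [CompleteSpace R] {A : ℝ → R} (hA : Continuous A) (s t : ℝ) :
    Summable fun n => dysonTerm A s n t := by
  obtain ⟨C, hC⟩ := (isCompact_closedBall s (|t - s| + 1)).exists_bound_of_continuousOn
    hA.continuousOn
  have ht : t ∈ Metric.ball s (|t - s| + 1) := by
    simp [Metric.mem_ball, Real.dist_eq]
  exact Summable.of_norm_bounded ((Real.summable_pow_div_factorial _).mul_left _) fun n =>
    dysonTerm_norm_le hA s _ C (fun r hr => hC r (Metric.ball_subset_closedBall hr)) n t ht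

theorem timeOrderedExp_self (A : ℝ → R) (s : ℝ) : timeOrderedExp A s s = 1 := by
  rw [timeOrderedExp, tsum_eq_single 0]
  · rfl
  · intro n hn
    obtain ⟨k, rfl⟩ := Nat.exists_eq_succ_of_ne_zero hn
    simp [dysonTerm]

/-- The time-ordered exponential solves `∂_t U(t, s) = A(t) U(t, s)`. -/
theorem timeOrderedExp_hasDerivAt [CompleteSpace R] {A : ℝ → R} (hA : Continuous A) (s t : ℝ) :
    HasDerivAt (timeOrderedExp A s) (A t * timeOrderedExp A s t) t := by
  obtain ⟨C, hC⟩ := (isCompact_closedBall s (|t - s| + 1)).exists_bound_of_continuousOn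
    hA.continuousOn
  have hC' : ∀ r ∈ Metric.ball s (|t - s| + 1), ‖A r‖ ≤ C :=
    fun r hr => hC r (Metric.ball_subset_closedBall hr)
  have ht : t ∈ Metric.ball s (|t - s| + 1) := by
    simp [Metric.mem_ball, Real.dist_eq]
  have hC0 : 0 ≤ C := (norm_nonneg _).trans (hC' t ht)
  have key : HasDerivAt (fun z => ∑' n, dysonTerm A s (n + 1) z)
      (∑' n, A t * dysonTerm A s n t) t := by
    refine hasDerivAt_tsum_of_isPreconnected
      (g := fun n => dysonTerm A s (n + 1)) (g' := fun n y => A y * dysonTerm A s n y)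
      (u := fun n => C * (‖(1 : R)‖ * ((C * (|t - s| + 1)) ^ n / (n.factorial : ℝ))))
      (((Real.summable_pow_div_factorial _).mul_left _).mul_left _) Metric.isOpen_ball
      (convex_ball s (|t - s| + 1)).isPreconnected
      (fun n y _ => dysonTerm_hasDerivAt hA s n y) ?_ ht
      ((summable_nat_add_iff 1).2 (dysonTerm_summable hA s t)) ht
    intro n y hy
    refine (norm_mul_le _ _).trans (mul_le_mul (hC' y hy) ?_ (norm_nonneg _) hC0)
    refine (dysonTerm_norm_le hA s _ C hC' n y hy).trans ?_
    have : |y - s| ≤ |t - s| + 1 := by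
      rw [← Real.dist_eq]; exact (Metric.mem_ball.1 hy).le
    gcongr
  rw [(dysonTerm_summable hA s t).tsum_mul_left] at key
  have heq : timeOrderedExp A s = fun z => 1 + ∑' n, dysonTerm A s (n + 1) z := by
    funext z
    exact (dysonTerm_summable hA s z).tsum_eq_zero_add
  have h := key.const_add (1 : R)
  rw [← heq] at h
  exact h

end DysonFacts

/-- The second-order midpoint (Strang) step for the time-independent Hamiltonian `∑ k, H k`:
`U₂(δ) = ∏_{k=1}^{Λ} e^{-i (δ/2) H_k} ∏_{k=Λ}^{1} e^{-i (δ/2) H_k}`. -/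
noncomputable def strangStep {ℋ : Type*} [NormedAddCommGroup ℋ] [InnerProductSpace ℂ ℋ]
    {Λ : ℕ} (H : Fin Λ → ℋ →L[ℂ] ℋ) (δ : ℝ) : ℋ →L[ℂ] ℋ :=
  prodAsc (fun k => NormedSpace.exp ((-Complex.I * ((δ / 2 : ℝ) : ℂ)) • H k)) *
    prodDesc (fun k => NormedSpace.exp ((-Complex.I * ((δ / 2 : ℝ) : ℂ)) • H k))

/-- The time-independent multi-product formula of order `2 m` with parameters `α j`, `κ j`,
for all splittings of a time-independent Hamiltonian on `ℋ` into `Λ` self-adjoint terms: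
`e^{-i H δ} = ∑_j α_j U₂(δ / κ_j)^{κ_j} + O(δ^{2m+1})` as `δ → 0⁺`. -/
def TimeIndependentMPF (ℋ : Type*) [NormedAddCommGroup ℋ] [InnerProductSpace ℂ ℋ]
    (Λ : ℕ) {M : ℕ} (α : Fin M → ℝ) (κ : Fin M → ℕ) (m : ℕ) : Prop :=
  ∀ H : Fin Λ → ℋ →L[ℂ] ℋ, (∀ k, ((H k : ℋ →L[ℂ] ℋ) : ℋ →ₗ[ℂ] ℋ).IsSymmetric) →
    (fun δ : ℝ => NormedSpace.exp ((-Complex.I * (δ : ℂ)) • ∑ k, H k) -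
        ∑ j, α j • strangStep H (δ / (κ j : ℝ)) ^ κ j)
      =O[𝓝[>] 0] fun δ : ℝ => δ ^ (2 * m + 1)

/-- The evolution operator `exp_𝒯 (-i ∫_s^t H(r) dr)`. The argument order is that of `U(t, s)`. -/
noncomputable def evolution {ℋ : Type*} [NormedAddCommGroup ℋ] [InnerProductSpace ℂ ℋ]
    (H : ℝ → ℋ →L[ℂ] ℋ) (t s : ℝ) : ℋ →L[ℂ] ℋ :=
  timeOrderedExp (fun r => (-Complex.I) • H r) s t

/-- The second-order Huyghebaert–De Raedt step
`Ũ₂(t, s) = ∏_{k=1}^{Λ} exp_𝒯 (-i ∫_{s+(t-s)/2}^{t} H_k) ∏_{k=Λ}^{1} exp_𝒯 (-i ∫_s^{s+(t-s)/2} H_k)`. -/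
noncomputable def hdrStep {ℋ : Type*} [NormedAddCommGroup ℋ] [InnerProductSpace ℂ ℋ]
    {Λ : ℕ} (H : Fin Λ → ℝ → ℋ →L[ℂ] ℋ) (t s : ℝ) : ℋ →L[ℂ] ℋ :=
  prodAsc (fun k => evolution (H k) t (s + (t - s) / 2)) *
    prodDesc (fun k => evolution (H k) (s + (t - s) / 2) s)

/-! ### Algebra of ordered products. -/

section OrderedProducts

variable {R : Type*} [Monoid R]

/-! The hypothesis is used only through the scalar order conditions it forces: `∑ α_j = 1` and `∑
α_j κ_j^(-2r) = 0` for `1 ≤ r ≤ m - 1`. These suffice for the time-dependent formula as well.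

Sufficiency. Seen from its midpoint, the symmetric step is time-reversible, so its defect is odd in
the half step `η`. Hence smooth `e_r`, with `e_0` the exact propagator, can be built so that `∑
η^(2r) e_r` follows the scheme to high order (`exists_modified_solution`): each `e_r` solves the
linear equation with a forcing that cancels the current leading defect, and oddness gives one
further order. After `κ_j` steps with `η = δ/(2κ_j)`, every `j` has reached the same time `t + δ`,
so the order conditions cancel all the `e_r(t + δ)` with `1 ≤ r ≤ m - 1`
(`isBigO_multiProduct_of_orderConditions`).

Necessity. Given two terms and two dimensions, the formula is tested on the matrix units `N = e₁₂`
and `P = e₁₁`. `N` is not self-adjoint, but it is the value at `i` of a holomorphic family that is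
self-adjoint at real parameters, and Taylor coefficients vanishing on the reals vanish everywhere.
The off-diagonal entry of the error is `(e^(-iδ) - 1)(1 - ∑ α_j y_j cot y_j)` with `y_j = δ/(2κ_j)`.
Every even Taylor coefficient of `y cot y` is nonzero, so each order condition can be read off
(`orderConditions_of_cot`).

With at most one term or one dimension the steps are exact, and `∑ α_j = 1` is enough. -/

theorem prodAsc_zero (A : Fin 0 → R) : prodAsc A = 1 := by simp [prodAsc]

theorem prodDesc_zero (A : Fin 0 → R) : prodDesc A = 1 := by simp [prodDesc]

theorem prodAsc_succ {n : ℕ} (A : Fin (n + 1) → R) :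
    prodAsc A = A 0 * prodAsc fun k => A k.succ := by
  simp [prodAsc, List.ofFn_succ]

theorem prodDesc_succ {n : ℕ} (A : Fin (n + 1) → R) :
    prodDesc A = (prodDesc fun k => A k.succ) * A 0 := by
  simp [prodDesc, List.ofFn_succ]

theorem prodDesc_castSucc {n : ℕ} (A : Fin (n + 1) → R) :
    prodDesc A = A (Fin.last n) * prodDesc fun k => A k.castSucc := by
  rw [prodDesc, List.ofFn_succ']
  simp [prodDesc]

theorem prodAsc_one (n : ℕ) : prodAsc (fun _ : Fin n => (1 : R)) = 1 := by
  simp [prodAsc]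

theorem prodDesc_one (n : ℕ) : prodDesc (fun _ : Fin n => (1 : R)) = 1 := by
  simp [prodDesc]

theorem prodAsc_mul_prodDesc {n : ℕ} (A B : Fin n → R) (h : ∀ k, A k * B k = 1) :
    prodAsc A * prodDesc B = 1 := by
  induction n with
  | zero => simp [prodAsc_zero, prodDesc_zero]
  | succ n ih =>
    rw [prodAsc_succ, prodDesc_succ, mul_assoc, ← mul_assoc (prodAsc _),
      ih _ _ fun k => h k.succ, one_mul, h 0]

end OrderedProducts

section OrderedProductsSmooth

variable {𝕜 : Type*} [NontriviallyNormedField 𝕜] {R : Type*} [NormedRing R] [NormedAlgebra 𝕜 R]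
  {E : Type*} [NormedAddCommGroup E] [NormedSpace 𝕜 E] {r : WithTop ℕ∞}

theorem ContDiff.prodAsc {n : ℕ} {A : Fin n → E → R} (hA : ∀ k, ContDiff 𝕜 r (A k)) :
    ContDiff 𝕜 r fun x => prodAsc fun k => A k x := by
  induction n with
  | zero => simpa only [prodAsc_zero] using contDiff_const
  | succ n ih =>
    simp only [prodAsc_succ]
    exact (hA 0).mul (ih fun k => hA k.succ)

theorem ContDiff.prodDesc {n : ℕ} {A : Fin n → E → R} (hA : ∀ k, ContDiff 𝕜 r (A k)) :
    ContDiff 𝕜 r fun x => prodDesc fun k => A k x := by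
  induction n with
  | zero => simpa only [prodDesc_zero] using contDiff_const
  | succ n ih =>
    simp only [prodDesc_succ]
    exact (ih fun k => hA k.succ).mul (hA 0)

end OrderedProductsSmooth

/-! ### Propagators: cocycle law, joint smoothness, variation of constants. -/

section Propagator

variable {R : Type*} [NormedRing R] [NormedAlgebra ℝ R] [CompleteSpace R]

omit [CompleteSpace R] in
/-- A solution of `f' = A f` is determined by its value at one time. -/
theorem linearODE_unique {A : ℝ → R} (hA : Continuous A) {f g : ℝ → R}
    (hf : ∀ t, HasDerivAt f (A t * f t) t) (hg : ∀ t, HasDerivAt g (A t * g t) t)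
    {s : ℝ} (hs : f s = g s) : f = g := by
  funext t
  obtain ⟨a, b, ht, hs'⟩ : ∃ a b, t ∈ Set.Ioo a b ∧ s ∈ Set.Ioo a b :=
    ⟨min t s - 1, max t s + 1, by constructor <;> grind,
      by constructor <;> grind⟩
  obtain ⟨C, hC⟩ := (isCompact_Icc (a := a) (b := b)).exists_bound_of_continuousOn hA.continuousOn
  refine ODE_solution_unique_of_mem_Ioo (v := fun r x => A r * x) (s := fun _ => Set.univ)
    (K := C.toNNReal) ?_ hs' (fun r _ => ⟨hf r, trivial⟩) (fun r _ => ⟨hg r, trivial⟩) hs ht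
  intro r hr
  refine LipschitzOnWith.of_dist_le_mul fun x _ y _ => ?_
  rw [dist_eq_norm, dist_eq_norm, ← mul_sub]
  refine (norm_mul_le _ _).trans ?_
  gcongr
  exact (hC r (Set.Ioo_subset_Icc_self hr)).trans (Real.le_coe_toNNReal C)

/-- Both sides solve the same equation in `t` and agree at `t = s`. With `f` itself a propagator
this is the cocycle law. -/
theorem timeOrderedExp_mul_eq {A : ℝ → R} (hA : Continuous A) {f : ℝ → R}
    (hf : ∀ t, HasDerivAt f (A t * f t) t) (s t : ℝ) :
    timeOrderedExp A s t * f s = f t := by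
  refine congrFun (linearODE_unique hA (s := s) (f := fun t => timeOrderedExp A s t * f s)
    (fun t => ?_) hf ?_) t
  · rw [← mul_assoc]
    exact (timeOrderedExp_hasDerivAt hA s t).mul_const _
  · simp [timeOrderedExp_self]

theorem timeOrderedExp_mul {A : ℝ → R} (hA : Continuous A) (r s t : ℝ) :
    timeOrderedExp A s t * timeOrderedExp A r s = timeOrderedExp A r t :=
  timeOrderedExp_mul_eq hA (timeOrderedExp_hasDerivAt hA r) s t

theorem timeOrderedExp_mul_symm {A : ℝ → R} (hA : Continuous A) (s t : ℝ) :
    timeOrderedExp A s t * timeOrderedExp A t s = 1 := by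
  rw [timeOrderedExp_mul hA, timeOrderedExp_self]

theorem contDiff_timeOrderedExp_right {A : ℝ → R} (hA : ContDiff ℝ ∞ A) (s : ℝ) :
    ContDiff ℝ ∞ (timeOrderedExp A s) := by
  have hd := timeOrderedExp_hasDerivAt hA.continuous s
  refine contDiff_infty.2 fun n => ?_
  induction n with
  | zero =>
    exact contDiff_zero.2 (continuous_iff_continuousAt.2 fun t => (hd t).continuousAt)
  | succ n ih =>
    push_cast
    refine contDiff_succ_iff_deriv.2 ⟨fun t => (hd t).differentiableAt, by simp, ?_⟩
    have : deriv (timeOrderedExp A s) = fun t => A t * timeOrderedExp A s t :=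
      funext fun t => (hd t).deriv
    rw [this]
    exact (contDiff_infty.1 hA n).mul ih

/-- Exchanging the two times inverts the propagator, and inversion is smooth at units; no equation
in the initial time is needed. -/
theorem contDiff_timeOrderedExp_left {A : ℝ → R} (hA : ContDiff ℝ ∞ A) (t : ℝ) :
    ContDiff ℝ ∞ fun s => timeOrderedExp A s t := by
  have hc := hA.continuous
  let u : ℝ → Rˣ := fun s => ⟨timeOrderedExp A t s, timeOrderedExp A s t,
    timeOrderedExp_mul_symm hc _ _, timeOrderedExp_mul_symm hc _ _⟩
  have : (fun s => timeOrderedExp A s t) = fun s => Ring.inverse (timeOrderedExp A t s) :=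
    funext fun s => (Ring.inverse_unit (u s)).symm
  rw [this]
  exact contDiff_iff_contDiffAt.2 fun s => (contDiffAt_ringInverse ℝ (u s)).comp s (f := timeOrderedExp A t)
    (contDiff_timeOrderedExp_right hA t).contDiffAt

/-- The propagator is jointly smooth in both times. -/
theorem ContDiff.timeOrderedExp {E : Type*} [NormedAddCommGroup E] [NormedSpace ℝ E]
    {A : ℝ → R} (hA : ContDiff ℝ ∞ A) {f g : E → ℝ} (hf : ContDiff ℝ ∞ f) (hg : ContDiff ℝ ∞ g) :
    ContDiff ℝ ∞ fun x => timeOrderedExp A (f x) (g x) := by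
  -- Factoring through time `0` separates the two time variables.
  have : (fun x => _root_.timeOrderedExp A (f x) (g x)) =
      fun x => _root_.timeOrderedExp A 0 (g x) * _root_.timeOrderedExp A (f x) 0 :=
    funext fun x => (timeOrderedExp_mul hA.continuous _ _ _).symm
  rw [this]
  exact ((contDiff_timeOrderedExp_right hA 0).comp hg).mul
    ((contDiff_timeOrderedExp_left hA 0).comp hf)

/-- Smooth solutions of the inhomogeneous linear equation, by variation of constants. -/
theorem exists_contDiff_inhomogeneous {A g : ℝ → R} (hA : ContDiff ℝ ∞ A) (hg : ContDiff ℝ ∞ g)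
    (s : ℝ) : ∃ f : ℝ → R, ContDiff ℝ ∞ f ∧ f s = 0 ∧
      ∀ t, HasDerivAt f (A t * f t + g t) t := by
  have hw : ContDiff ℝ ∞ fun r => timeOrderedExp A r s * g r :=
    (contDiff_timeOrderedExp_left hA s).mul hg
  have hI (t : ℝ) : HasDerivAt (fun t => ∫ r in s..t, timeOrderedExp A r s * g r)
      (timeOrderedExp A t s * g t) t :=
    intervalIntegral.integral_hasDerivAt_right (hw.continuous.intervalIntegrable s t)
      (hw.continuous.stronglyMeasurableAtFilter _ _) hw.continuous.continuousAt
  have hIs : ContDiff ℝ ∞ fun t => ∫ r in s..t, timeOrderedExp A r s * g r := by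
    refine contDiff_infty_iff_deriv.2 ⟨fun t => (hI t).differentiableAt, ?_⟩
    rwa [funext fun t => (hI t).deriv]
  refine ⟨_, (contDiff_timeOrderedExp_right hA s).mul hIs, by simp, fun t => ?_⟩
  convert! (timeOrderedExp_hasDerivAt hA.continuous s t).mul (hI t) using 1
  rw [← mul_assoc (timeOrderedExp A s t), timeOrderedExp_mul_symm hA.continuous, one_mul, mul_assoc]

end Propagator

/-! ### Taylor expansions, locally uniform in a parameter. -/

theorem isBigO_pow_of_le {k n : ℕ} (h : n ≤ k) :
    (fun x : ℝ => x ^ k) =O[𝓝[>] 0] fun x => x ^ n := by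
  refine IsBigO.of_bound 1 ?_
  filter_upwards [Ioo_mem_nhdsGT (zero_lt_one' ℝ)] with x hx
  rw [one_mul, norm_pow, norm_pow, Real.norm_of_nonneg hx.1.le]
  exact pow_le_pow_of_le_one hx.1.le hx.2.le h

section TaylorRCLike

variable {𝕜 : Type*} [RCLike 𝕜] {E : Type*} [NormedAddCommGroup E] [NormedSpace 𝕜 E]

/-- Integrating a bound on the derivative in the second variable, locally uniformly in the first. -/
theorem isBigO_snd_pow_succ {Φ Ψ : 𝕜 × 𝕜 → E} {c : 𝕜} {n : ℕ}
    (hΦ : ∀ p : 𝕜 × 𝕜, HasDerivAt (fun η => Φ (p.1, η)) (Ψ p) p.2)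
    (h0 : ∀ x, Φ (x, 0) = 0) (hΨ : Ψ =O[𝓝 (c, 0)] fun p => p.2 ^ n) :
    Φ =O[𝓝 (c, 0)] fun p => p.2 ^ (n + 1) := by
  obtain ⟨K, hK⟩ := hΨ.bound
  obtain ⟨ε, hε, hball⟩ := Metric.eventually_nhds_iff_ball.1 hK
  refine IsBigO.of_bound K (Metric.eventually_nhds_iff_ball.2 ⟨ε, hε, fun p hp => ?_⟩)
  have hp' : p.1 ∈ Metric.ball c ε ∧ p.2 ∈ Metric.ball (0 : 𝕜) ε := by
    rwa [← Set.mem_prod, ball_prod_same]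
  have hsub : ∀ η ∈ segment ℝ 0 p.2, ‖η‖ ≤ ‖p.2‖ := fun η hη => by
    have := (convex_closedBall (0 : 𝕜) ‖p.2‖).segment_subset (by simp) (by simp) hη
    simpa using this
  have key : ∀ η ∈ segment ℝ 0 p.2, ‖Ψ (p.1, η)‖ ≤ K * ‖p.2 ^ n‖ := fun η hη => by
    have h1 := hsub η hη
    have hη' : (p.1, η) ∈ Metric.ball (c, (0 : 𝕜)) ε := by
      rw [← ball_prod_same]
      refine ⟨hp'.1, ?_⟩
      have := hp'.2
      rw [mem_ball_zero_iff] at this ⊢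
      exact h1.trans_lt this
    have h2 := hball _ hη'
    rcases le_or_gt 0 K with hK0 | hK0
    · refine h2.trans ?_
      simp only [norm_pow]
      gcongr
    -- A negative `K` is possible only where `p.2 ^ n` vanishes, and then the bound is zero along
    -- the whole segment.
    · have h3 := hball p hp
      have h4 : ‖p.2 ^ n‖ = 0 := by
        by_contra h
        have := mul_neg_of_neg_of_pos hK0 (lt_of_le_of_ne (norm_nonneg _) (Ne.symm h))
        exact absurd (h3.trans_lt this) (not_lt.2 (norm_nonneg _))
      have h5 : ‖η ^ n‖ = 0 := by
        refine le_antisymm ?_ (norm_nonneg _)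
        rw [← h4]
        simp only [norm_pow]
        gcongr
      rw [h4, mul_zero]
      simpa [h5] using h2
  have := (convex_segment (𝕜 := ℝ) (0 : 𝕜) p.2).norm_image_sub_le_of_norm_hasDerivWithin_le
    (f := fun η => Φ (p.1, η)) (f' := fun η => Ψ (p.1, η))
    (fun η _ => (hΦ (p.1, η)).hasDerivWithinAt) key (left_mem_segment ℝ _ _) (right_mem_segment ℝ _ _)
  simpa [h0, pow_succ, mul_assoc] using this

/-- Taylor expansion in the second variable, locally uniformly in the first. -/
theorem exists_taylor_snd (n : ℕ) {Φ : 𝕜 × 𝕜 → E} (hΦ : ContDiff 𝕜 ∞ Φ) :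
    ∃ g : ℕ → 𝕜 → E, (∀ i, ContDiff 𝕜 ∞ (g i)) ∧ ∀ c,
      (fun p : 𝕜 × 𝕜 => Φ p - ∑ i ∈ Finset.range n, p.2 ^ i • g i p.1)
        =O[𝓝 (c, 0)] fun p => p.2 ^ n := by
  induction n generalizing Φ with
  | zero =>
    refine ⟨fun _ _ => 0, fun _ => contDiff_const, fun c => ?_⟩
    simpa using hΦ.continuous.continuousAt.norm.isBoundedUnder_le
  | succ n ih =>
    have hd (p : 𝕜 × 𝕜) : HasDerivAt (fun η => Φ (p.1, η)) (fderiv 𝕜 Φ p (0, 1)) p.2 :=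
      HasFDerivAt.comp_hasDerivAt (l := Φ) (f := fun η => (p.1, η)) p.2
        (hΦ.differentiable (by simp) (p.1, p.2)).hasFDerivAt
        ((hasDerivAt_const p.2 p.1).prodMk (hasDerivAt_id p.2))
    obtain ⟨g, hg, hO⟩ := ih (Φ := fun p => fderiv 𝕜 Φ p (0, 1))
      ((hΦ.fderiv_right (by simp)).clm_apply contDiff_const)
    refine ⟨fun i c => Nat.casesOn i (Φ (c, 0)) fun i => ((i : 𝕜) + 1)⁻¹ • g i c, ?_, fun c => ?_⟩
    · rintro (_ | i)
      · exact hΦ.comp (contDiff_id.prodMk contDiff_const)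
      · exact contDiff_const.smul (hg i)
    · refine isBigO_snd_pow_succ (fun p => ?_) (fun x => ?_) (hO c)
      · refine (hd p).sub ?_
        simp only [Finset.sum_range_succ', pow_zero, one_smul]
        have hi (i : ℕ) : HasDerivAt (fun η : 𝕜 => η ^ (i + 1) • ((i : 𝕜) + 1)⁻¹ • g i p.1)
            (p.2 ^ i • g i p.1) p.2 := by
          refine ((hasDerivAt_pow (i + 1) p.2).smul_const _).congr_deriv ?_
          rw [smul_smul]
          congr 1
          push_cast
          have := Nat.cast_add_one_ne_zero (R := 𝕜) i
          field_simp
        exact (HasDerivAt.fun_sum (u := Finset.range n) fun i _ => hi i).add_const (Φ (p.1, 0))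
      · simp [Finset.sum_range_succ']

end TaylorRCLike

section Curves

variable {E : Type*} [NormedAddCommGroup E]

theorem isBigO_snd_curve {Φ : ℝ × ℝ → E} {c : ℝ} {n : ℕ}
    (h : Φ =O[𝓝 (c, 0)] fun p => p.2 ^ n) {x y : ℝ → ℝ} (hx : Continuous x) (hy : Continuous y)
    (hx0 : x 0 = c) (hy0 : y 0 = 0) :
    (fun δ => Φ (x δ, y δ)) =O[𝓝[>] 0] fun δ => y δ ^ n := by
  have ht : Tendsto (fun δ => (x δ, y δ)) (𝓝[>] 0) (𝓝 (c, 0)) := by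
    have := (hx.prodMk hy).tendsto 0
    rw [hx0, hy0] at this
    exact this.mono_left nhdsWithin_le_nhds
  exact h.comp_tendsto ht

end Curves

section Taylor

variable {E : Type*} [NormedAddCommGroup E] [NormedSpace ℝ E]

/-- The limit at `0` kills the constant term; divide by `x` and induct. -/
theorem eq_zero_of_sum_pow_smul_isBigO {n : ℕ} {a : ℕ → E}
    (h : (fun x : ℝ => ∑ i ∈ Finset.range n, x ^ i • a i) =O[𝓝[>] 0] fun x => x ^ n) :
    ∀ i < n, a i = 0 := by
  induction n generalizing a with
  | zero => simp
  | succ n ih =>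
    have h0 : a 0 = 0 := by
      have h1 : Tendsto (fun x : ℝ => ∑ i ∈ Finset.range (n + 1), x ^ i • a i) (𝓝[>] 0) (𝓝 0) := by
        refine h.trans_tendsto ?_
        have : Continuous fun x : ℝ => x ^ (n + 1) := by fun_prop
        simpa using (this.tendsto 0).mono_left nhdsWithin_le_nhds
      have h2 : Continuous fun x : ℝ => ∑ i ∈ Finset.range (n + 1), x ^ i • a i := by fun_prop
      have h3 := (h2.tendsto 0).mono_left (nhdsWithin_le_nhds (s := Set.Ioi 0))
      have := tendsto_nhds_unique h3 h1
      simpa [Finset.sum_range_succ'] using this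
    have h4 : (fun x : ℝ => ∑ i ∈ Finset.range n, x ^ i • a (i + 1)) =O[𝓝[>] 0]
        fun x => x ^ n := by
      have h5 := (isBigO_refl (fun x : ℝ => x⁻¹) (𝓝[>] 0)).smul h
      refine (h5.congr' ?_ ?_)
      · filter_upwards [self_mem_nhdsWithin] with x (hx : 0 < x)
        rw [Finset.sum_range_succ', h0, smul_zero, add_zero, Finset.smul_sum]
        refine Finset.sum_congr rfl fun i _ => ?_
        rw [smul_smul, pow_succ', inv_mul_cancel_left₀ hx.ne']
      · filter_upwards [self_mem_nhdsWithin] with x (hx : 0 < x)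
        rw [smul_eq_mul, pow_succ', inv_mul_cancel_left₀ hx.ne']
    rintro (_ | i) hi
    · exact h0
    · exact ih h4 i (by omega)

/-- The leading Taylor coefficient of a function that vanishes to order `n`. -/
theorem exists_leading_coeff {n : ℕ} {Φ : ℝ × ℝ → E} (hΦ : ContDiff ℝ ∞ Φ)
    (h : ∀ c, Φ =O[𝓝 (c, 0)] fun p => p.2 ^ n) :
    ∃ g : ℝ → E, ContDiff ℝ ∞ g ∧ ∀ c,
      (fun p : ℝ × ℝ => Φ p - p.2 ^ n • g p.1) =O[𝓝 (c, 0)] fun p => p.2 ^ (n + 1) := by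
  obtain ⟨g, hg, hO⟩ := exists_taylor_snd (n + 1) hΦ
  refine ⟨g n, hg n, fun c => ?_⟩
  have hz : ∀ i < n, g i = 0 := fun i hi => by
    funext c
    refine eq_zero_of_sum_pow_smul_isBigO (n := n) (a := fun i => g i c) ?_ i hi
    have hO' := isBigO_snd_curve (hO c) (x := fun _ => c) (y := fun δ => δ) continuous_const
      continuous_id rfl rfl
    have h' := isBigO_snd_curve (h c) (x := fun _ => c) (y := fun δ => δ) continuous_const
      continuous_id rfl rfl
    have hpow : (fun x : ℝ => x ^ (n + 1)) =O[𝓝[>] 0] fun x => x ^ n :=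
      isBigO_pow_of_le (Nat.le_succ n)
    have hlast : (fun δ : ℝ => δ ^ n • g n c) =O[𝓝[>] 0] fun δ => δ ^ n :=
      isBigO_of_le' (c := ‖g n c‖) _ fun δ => by rw [norm_smul, mul_comm]
    refine (((h'.sub (hO'.trans hpow)).sub hlast)).congr_left fun δ => ?_
    simp [Finset.sum_range_succ]
  refine (hO c).congr_left fun p => ?_
  rw [Finset.sum_range_succ, Finset.sum_eq_zero, zero_add]
  intro i hi
  simp [hz i (Finset.mem_range.1 hi)]

theorem tendsto_neg_snd (c : ℝ) :
    Tendsto (fun p : ℝ × ℝ => (p.1, -p.2)) (𝓝 (c, 0)) (𝓝 (c, 0)) := by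
  have : Continuous fun p : ℝ × ℝ => (p.1, -p.2) := by fun_prop
  simpa using this.tendsto (c, 0)

/-- An odd function that vanishes to an even order vanishes to the next order. -/
theorem isBigO_succ_of_odd {n : ℕ} {Φ : ℝ × ℝ → E} (hΦ : ContDiff ℝ ∞ Φ)
    (hodd : ∀ c η, Φ (c, -η) = -Φ (c, η)) (hn : Even n)
    (h : ∀ c, Φ =O[𝓝 (c, 0)] fun p => p.2 ^ n) (c : ℝ) :
    Φ =O[𝓝 (c, 0)] fun p => p.2 ^ (n + 1) := by
  obtain ⟨g, -, hO⟩ := exists_leading_coeff hΦ h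
  have h1 := (hO c).comp_tendsto (tendsto_neg_snd c)
  have h2 : (fun p : ℝ × ℝ => -Φ p - p.2 ^ n • g p.1) =O[𝓝 (c, 0)] fun p => p.2 ^ (n + 1) := by
    refine (h1.congr_left fun p => ?_).trans (isBigO_of_le _ fun p => ?_)
    · simp [hodd, hn.neg_pow]
    · simp
  -- For even `n` the leading term is the same at `η` and `-η`, while `Φ` changes sign: subtracting
  -- cancels the former and leaves `2 Φ`.
  refine (((hO c).sub h2).const_smul_left (2⁻¹ : ℝ)).congr_left fun p => ?_
  simp only [Pi.smul_apply]
  module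

end Taylor

/-! ### Symmetric splitting steps and their expansion in even powers. -/

section SplitStep

variable {R : Type*} [NormedRing R] [NormedAlgebra ℝ R] {Λ : ℕ}

/-- The product of the propagators from `c` to `c + η`, the first one leftmost. -/
noncomputable def splitForward (A : Fin Λ → ℝ → R) (p : ℝ × ℝ) : R :=
  prodAsc fun k => timeOrderedExp (A k) p.1 (p.1 + p.2)

/-- The product of the propagators from `c + η` to `c`, the first one rightmost. -/
noncomputable def splitBackward (A : Fin Λ → ℝ → R) (p : ℝ × ℝ) : R :=
  prodDesc fun k => timeOrderedExp (A k) (p.1 + p.2) p.1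

/-- The symmetric splitting step from `s` to `t`. -/
noncomputable def splitStep (A : Fin Λ → ℝ → R) (t s : ℝ) : R :=
  (prodAsc fun k => timeOrderedExp (A k) (s + (t - s) / 2) t) *
    prodDesc fun k => timeOrderedExp (A k) s (s + (t - s) / 2)

/-- The defect of `V` in the step from `c - η` to `c + η`, pulled back to the midpoint `c`. -/
noncomputable def splitDefect (A : Fin Λ → ℝ → R) (V : ℝ → R) (p : ℝ × ℝ) : R :=
  splitBackward A p * V (p.1 + p.2) - splitBackward A (p.1, -p.2) * V (p.1 + -p.2)

/-- In midpoint coordinates both halves are based at `c`, and the left half is inverted by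
`splitBackward` at `+η`. -/
theorem splitStep_eq (A : Fin Λ → ℝ → R) (c η : ℝ) :
    splitStep A (c + η) (c - η) = splitForward A (c, η) * splitBackward A (c, -η) := by
  have : c - η + (c + η - (c - η)) / 2 = c := by ring
  rw [splitStep, this, splitForward, splitBackward, ← sub_eq_add_neg]

theorem splitBackward_zero (A : Fin Λ → ℝ → R) (c : ℝ) : splitBackward A (c, 0) = 1 := by
  simp [splitBackward, timeOrderedExp_self, prodDesc_one]

/-- This is the time-reversal symmetry of the step, and the source of the purely even expansion. -/
theorem splitDefect_neg (A : Fin Λ → ℝ → R) (V : ℝ → R) (c η : ℝ) :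
    splitDefect A V (c, -η) = -splitDefect A V (c, η) := by
  simp [splitDefect]

theorem hasDerivAt_prodDesc_of_eq_one {n : ℕ} {B : Fin n → ℝ → R} {b : Fin n → R} {x : ℝ}
    (hB : ∀ k, HasDerivAt (B k) (b k) x) (h1 : ∀ k, B k x = 1) :
    HasDerivAt (fun y => prodDesc fun k => B k y) (∑ k, b k) x := by
  induction n with
  | zero => simpa [prodDesc_zero] using hasDerivAt_const x (1 : R)
  | succ n ih =>
    simp only [prodDesc_succ]
    refine ((ih (fun k => hB k.succ) fun k => h1 k.succ).mul (hB 0)).congr_deriv ?_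
    simp [h1, prodDesc_one, Fin.sum_univ_succ, add_comm]

variable [CompleteSpace R]

theorem hasDerivAt_timeOrderedExp_left_self {A : ℝ → R} (hA : ContDiff ℝ ∞ A) (c : ℝ) :
    HasDerivAt (fun η => timeOrderedExp A (c + η) c) (-A c) 0 := by
  have h1 : HasDerivAt (fun η => timeOrderedExp A c (c + η)) (A c) 0 := by
    have := (timeOrderedExp_hasDerivAt hA.continuous c (c + 0)).comp_const_add c 0
    simpa [timeOrderedExp_self] using this
  have hs : ContDiff ℝ ∞ fun η => timeOrderedExp A (c + η) c :=
    hA.timeOrderedExp (by fun_prop) contDiff_const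
  have h2 := (hs.differentiable (by simp) 0).hasDerivAt
  have h3 := h2.mul h1
  have h4 : (fun η => timeOrderedExp A (c + η) c) * (fun η => timeOrderedExp A c (c + η)) =
      fun _ => 1 := funext fun η => timeOrderedExp_mul_symm hA.continuous _ _
  rw [h4] at h3
  have h5 := h3.unique (hasDerivAt_const 0 (1 : R))
  simp only [add_zero, timeOrderedExp_self, mul_one, one_mul] at h5
  rwa [← eq_neg_of_add_eq_zero_left h5]

variable {A : Fin Λ → ℝ → R} (hA : ∀ k, ContDiff ℝ ∞ (A k))
include hA

theorem splitForward_mul_splitBackward (p : ℝ × ℝ) :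
    splitForward A p * splitBackward A p = 1 :=
  prodAsc_mul_prodDesc _ _ fun k => timeOrderedExp_mul_symm (hA k).continuous _ _

theorem contDiff_splitForward : ContDiff ℝ ∞ (splitForward A) :=
  ContDiff.prodAsc fun k => (hA k).timeOrderedExp (by fun_prop) (by fun_prop)

theorem contDiff_splitBackward : ContDiff ℝ ∞ (splitBackward A) :=
  ContDiff.prodDesc fun k => (hA k).timeOrderedExp (by fun_prop) (by fun_prop)

theorem contDiff_splitDefect {V : ℝ → R} (hV : ContDiff ℝ ∞ V) :
    ContDiff ℝ ∞ (splitDefect A V) := by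
  have h := contDiff_splitBackward hA
  refine (h.mul (hV.comp (by fun_prop))).sub ((h.comp (?_ : ContDiff ℝ ∞
    fun p : ℝ × ℝ => (p.1, -p.2))).mul (hV.comp (by fun_prop)))
  fun_prop

/-- The backward product has derivative `-∑ A_k` at `η = 0`; antisymmetrizing in `η` doubles the
derivative of `splitBackward * V`. -/
theorem hasDerivAt_splitDefect {V : ℝ → R} {v : R} {c : ℝ} (hV : HasDerivAt V v c) :
    HasDerivAt (fun η => splitDefect A V (c, η)) ((2 : ℝ) • (v - (∑ k, A k c) * V c)) 0 := by
  have h1 : HasDerivAt (fun η => splitBackward A (c, η)) (∑ k, -A k c) 0 :=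
    hasDerivAt_prodDesc_of_eq_one (fun k => hasDerivAt_timeOrderedExp_left_self (hA k) c)
      fun k => by simp [timeOrderedExp_self]
  have h2 : HasDerivAt (fun η => V (c + η)) v 0 := by
    rw [← add_zero c] at hV
    exact hV.comp_const_add c 0
  have h3 := h1.mul h2
  have h3' := h3
  rw [← neg_zero] at h3'
  have h4 := h3.sub ((h3'.scomp (0 : ℝ) (hasDerivAt_neg 0)))
  refine h4.congr_deriv ?_
  simp only [add_zero, neg_zero, splitBackward_zero, Finset.sum_neg_distrib, two_smul]
  simp
  abel

/-- A forcing `w` in the equation appears in the defect as `2 η w`, so the forcing can be chosen to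
produce any prescribed leading defect. -/
theorem splitDefect_isBigO_sub {V : ℝ → R} (hV : ContDiff ℝ ∞ V) {w : ℝ → R}
    (hw : ∀ c, HasDerivAt V ((∑ k, A k c) * V c + w c) c) (c : ℝ) :
    (fun p : ℝ × ℝ => splitDefect A V p - p.2 • ((2 : ℝ) • w p.1)) =O[𝓝 (c, 0)]
      fun p => p.2 ^ 2 := by
  have hD := contDiff_splitDefect hA hV
  have hd (p : ℝ × ℝ) : HasDerivAt (fun η => splitDefect A V (p.1, η))
      (fderiv ℝ (splitDefect A V) p (0, 1)) p.2 :=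
    HasFDerivAt.comp_hasDerivAt (l := splitDefect A V) (f := fun η => (p.1, η)) p.2
      (hD.differentiable (by simp) (p.1, p.2)).hasFDerivAt
      ((hasDerivAt_const p.2 p.1).prodMk (hasDerivAt_id p.2))
  have hO (c : ℝ) : splitDefect A V =O[𝓝 (c, 0)] fun p => p.2 ^ 1 := by
    refine isBigO_snd_pow_succ hd (fun x => by simp [splitDefect]) ?_
    have : Continuous fun p => fderiv ℝ (splitDefect A V) p (0, 1) :=
      ((hD.fderiv_right (m := ∞) (by simp)).clm_apply contDiff_const).continuous
    simpa using this.continuousAt.norm.isBoundedUnder_le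
  obtain ⟨g, -, hg⟩ := exists_leading_coeff hD hO
  have hgw : g = fun c => (2 : ℝ) • w c := by
    funext c
    have h1 := hasDerivAt_splitDefect hA (hw c)
    rw [add_sub_cancel_left] at h1
    refine HasDerivAt.unique (f := fun η => splitDefect A V (c, η)) (x := 0) ?_ h1
    rw [hasDerivAt_iff_isLittleO]
    have ht : Tendsto (fun η : ℝ => (c, η)) (𝓝 0) (𝓝 (c, 0)) :=
      (Continuous.prodMk_right c).tendsto 0
    have h2 := (hg c).comp_tendsto ht
    have h3 : (fun η : ℝ => η ^ (1 + 1)) =o[𝓝 0] fun η => η - 0 := by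
      simpa using isLittleO_pow_id one_lt_two
    refine (h2.trans_isLittleO h3).congr_left fun η => ?_
    simp [splitDefect]
  subst hgw
  simpa using hg c

/-- Even-power correction terms: a family `e r` of smooth functions, starting from the exact
propagator, for which `∑ r, η ^ (2 r) • e r` satisfies the splitting scheme to high order. -/
theorem exists_modified_solution (t : ℝ) (m : ℕ) :
    ∃ e : ℕ → ℝ → R, (∀ r, ContDiff ℝ ∞ (e r)) ∧
      e 0 = timeOrderedExp (fun r => ∑ k, A k r) t ∧ (∀ r, 1 ≤ r → e r t = 0) ∧
      ∀ c, (fun p : ℝ × ℝ => ∑ r ∈ Finset.range (m + 1), p.2 ^ (2 * r) • splitDefect A (e r) p)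
        =O[𝓝 (c, 0)] fun p => p.2 ^ (2 * m + 3) := by
  have hS : ContDiff ℝ ∞ fun r => ∑ k, A k r := ContDiff.sum fun k _ => hA k
  have hodd (e : ℕ → ℝ → R) (m : ℕ) (c η : ℝ) :
      ∑ r ∈ Finset.range m, (-η) ^ (2 * r) • splitDefect A (e r) (c, -η) =
        -∑ r ∈ Finset.range m, η ^ (2 * r) • splitDefect A (e r) (c, η) := by
    rw [← Finset.sum_neg_distrib]
    exact Finset.sum_congr rfl fun r _ => by
      rw [splitDefect_neg, (even_two_mul r).neg_pow, smul_neg]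
  have hsm {e : ℕ → ℝ → R} (he : ∀ r, ContDiff ℝ ∞ (e r)) (m : ℕ) : ContDiff ℝ ∞
      fun p : ℝ × ℝ => ∑ r ∈ Finset.range m, p.2 ^ (2 * r) • splitDefect A (e r) p :=
    ContDiff.sum fun r _ => (contDiff_snd.pow _).smul (contDiff_splitDefect hA (he r))
  induction m with
  | zero =>
    let e : ℕ → ℝ → R := fun r =>
      if r = 0 then timeOrderedExp (fun r => ∑ k, A k r) t else fun _ => 0
    have he : ∀ r, ContDiff ℝ ∞ (e r) := fun r => by
      by_cases hr : r = 0
      · simpa [e, hr] using contDiff_timeOrderedExp_right hS t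
      · simpa [e, hr] using contDiff_const
    refine ⟨e, he, rfl, fun r hr => by simp [e, Nat.one_le_iff_ne_zero.1 hr], ?_⟩
    -- The exact propagator has no forcing, so its defect is `O(η²)`, and by oddness `O(η³)`.
    refine isBigO_succ_of_odd (n := 2) (hsm he 1) (hodd e 1) even_two fun c => ?_
    have := splitDefect_isBigO_sub hA (he 0) (w := fun _ => 0)
      (fun c => by simpa [e] using timeOrderedExp_hasDerivAt hS.continuous t c) c
    simpa using this
  | succ m ih =>
    obtain ⟨e, he, he0, het, hO⟩ := ih
    obtain ⟨g, hg, hgO⟩ := exists_leading_coeff (hsm he (m + 1)) hO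
    -- With forcing `-g/2`, the correction `η^(2m+2) f` has defect `-η^(2m+3) g` to leading order,
    -- cancelling the present one. The initial value `0` keeps the sum exact at time `t`.
    obtain ⟨f, hf, hft, hf'⟩ := exists_contDiff_inhomogeneous hS
      (hg.const_smul (-2⁻¹ : ℝ)) t
    let e' : ℕ → ℝ → R := Function.update e (m + 1) f
    have he' : ∀ r, ContDiff ℝ ∞ (e' r) := fun r => by
      by_cases hr : r = m + 1
      · subst hr; simpa [e'] using hf
      · simpa [e', hr] using he r
    refine ⟨e', he', by simp [e', he0], fun r hr => ?_, ?_⟩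
    · by_cases hr' : r = m + 1
      · subst hr'; simpa [e'] using hft
      · simpa [e', hr'] using het r hr
    refine isBigO_succ_of_odd (n := 2 * m + 4) (hsm he' _) (hodd e' _)
      ⟨m + 2, by ring⟩ fun c => ?_
    have h1 := ((isBigO_refl (fun p : ℝ × ℝ => p.2 ^ (2 * (m + 1))) (𝓝 (c, 0))).smul
      (splitDefect_isBigO_sub hA hf hf' c))
    have h2 := (hgO c).add (h1.congr_right fun p => ?_)
    · refine h2.congr_left fun p => ?_
      have hsum : ∑ r ∈ Finset.range (m + 1), p.2 ^ (2 * r) • splitDefect A (e' r) p =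
          ∑ r ∈ Finset.range (m + 1), p.2 ^ (2 * r) • splitDefect A (e r) p :=
        Finset.sum_congr rfl fun r hr => by
          rw [show e' r = e r from Function.update_of_ne (Finset.mem_range.1 hr).ne _ _]
      rw [Finset.sum_range_succ _ (m + 1), show e' (m + 1) = f by simp [e'], hsum]
      have : p.2 ^ (2 * m + 3) = p.2 ^ (2 * (m + 1)) * p.2 := by ring
      rw [this]
      module
    · rw [smul_eq_mul]; ring

/-- Asymptotic expansion, in even powers of the step, of `n` symmetric splitting steps. -/
theorem exists_splitStep_expansion (t : ℝ) (m : ℕ) :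
    ∃ e : ℕ → ℝ → R, (∀ r, Continuous (e r)) ∧
      e 0 = timeOrderedExp (fun r => ∑ k, A k r) t ∧
      ∀ n : ℕ, (fun η : ℝ => ∑ r ∈ Finset.range (m + 1), η ^ (2 * r) • e r (t + n * (2 * η)) -
          prodDesc fun l : Fin n =>
            splitStep A (t + ((l : ℕ) + 1 : ℝ) * (2 * η)) (t + (l : ℕ) * (2 * η)))
        =O[𝓝[>] 0] fun η => η ^ (2 * m + 3) := by
  obtain ⟨e, he, he0, het, hO⟩ := exists_modified_solution hA t m
  refine ⟨e, fun r => (he r).continuous, he0, fun n => ?_⟩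
  induction n with
  | zero =>
    refine (isBigO_zero _ _).congr_left fun η => ?_
    simp [Finset.sum_range_succ', prodDesc_zero, het, he0, timeOrderedExp_self]
  | succ n ih =>
    -- The number of steps is fixed as `η → 0`, so local errors are multiplied by bounded factors
    -- and the order of the local defect is kept.
    have hF := (contDiff_splitForward hA).continuous
    have hB := (contDiff_splitBackward hA).continuous
    have hbdd {f : ℝ → R} (hf : Continuous f) : f =O[𝓝[>] 0] fun _ => (1 : ℝ) := by
      have := (hf.tendsto 0).mono_left (nhdsWithin_le_nhds (s := Set.Ioi 0))
      exact this.isBigO_one ℝ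
    -- `t + (2n+1)η` is the midpoint of the step being added.
    have h1 := isBigO_snd_curve (hO t) (x := fun η => t + (2 * n + 1) * η) (y := fun η => η)
      (by fun_prop) continuous_id (by simp) rfl
    have h2 := (hbdd (f := fun η => splitForward A (t + (2 * n + 1) * η, η))
      (by fun_prop)).mul h1
    have h3 := (hbdd (f := fun η => splitForward A (t + (2 * n + 1) * η, η) *
      splitBackward A (t + (2 * n + 1) * η, -η)) (by fun_prop)).mul ih
    simp only [one_mul] at h2 h3
    refine (h2.add h3).congr_left fun η => ?_
    rw [prodDesc_castSucc]
    simp only [Fin.val_last, Fin.val_castSucc]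
    rw [show t + ((n : ℝ) + 1) * (2 * η) = t + (2 * n + 1) * η + η by ring,
      show t + (n : ℝ) * (2 * η) = t + (2 * n + 1) * η - η by ring, splitStep_eq, mul_sub,
      show t + ((n + 1 : ℕ) : ℝ) * (2 * η) = t + (2 * n + 1) * η + η by push_cast; ring]
    have key : ∀ V : ℝ → R, splitForward A (t + (2 * n + 1) * η, η) *
        splitDefect A V (t + (2 * n + 1) * η, η) = V (t + (2 * n + 1) * η + η) -
          splitForward A (t + (2 * n + 1) * η, η) *
            splitBackward A (t + (2 * n + 1) * η, -η) * V (t + (2 * n + 1) * η - η) := fun V => by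
      rw [splitDefect, mul_sub, ← mul_assoc, splitForward_mul_splitBackward hA, one_mul,
        ← mul_assoc, ← sub_eq_add_neg]
    simp only [Finset.mul_sum, mul_smul_comm, key, smul_sub, Finset.sum_sub_distrib]
    abel

/-- The multi-product formula for symmetric splitting steps, from the order conditions. -/
theorem isBigO_multiProduct_of_orderConditions {M : ℕ} {α : Fin M → ℝ} {κ : Fin M → ℕ}
    (hκ : ∀ j, 1 ≤ κ j) (m : ℕ) (h0 : ∑ j, α j = 1)
    (hr : ∀ r, 1 ≤ r → r ≤ m → ∑ j, α j * ((2 * κ j : ℝ)⁻¹) ^ (2 * r) = 0) (t : ℝ) :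
    (fun δ : ℝ => timeOrderedExp (fun r => ∑ k, A k r) t (t + δ) -
        ∑ j, α j • prodDesc fun l : Fin (κ j) =>
          splitStep A (t + ((l : ℕ) + 1 : ℝ) * δ / (κ j : ℝ)) (t + (l : ℕ) * δ / (κ j : ℝ)))
      =O[𝓝[>] 0] fun δ => δ ^ (2 * m + 3) := by
  obtain ⟨e, -, he0, hO⟩ := exists_splitStep_expansion hA t m
  have hκ' (j) : (0 : ℝ) < κ j := by exact_mod_cast hκ j
  -- With `η = δ / (2 κ j)` the last of the `κ j` steps ends at `t + δ` for every `j`: the vectors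
  -- `e r (t + δ)` are common and only scalar weights depend on `j`.
  have h1 (j : Fin M) : (fun δ : ℝ => α j • (∑ r ∈ Finset.range (m + 1),
      (δ * (2 * κ j : ℝ)⁻¹) ^ (2 * r) • e r (t + δ) - prodDesc fun l : Fin (κ j) =>
        splitStep A (t + ((l : ℕ) + 1 : ℝ) * δ / (κ j : ℝ)) (t + (l : ℕ) * δ / (κ j : ℝ))))
      =O[𝓝[>] 0] fun δ => δ ^ (2 * m + 3) := by
    have ht : Tendsto (fun δ : ℝ => δ * (2 * κ j : ℝ)⁻¹) (𝓝[>] 0) (𝓝[>] 0) := by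
      refine tendsto_nhdsWithin_iff.2 ⟨?_, ?_⟩
      · have : Continuous fun δ : ℝ => δ * (2 * κ j : ℝ)⁻¹ := by fun_prop
        simpa using (this.tendsto 0).mono_left (nhdsWithin_le_nhds (s := Set.Ioi 0))
      · filter_upwards [self_mem_nhdsWithin] with δ (hδ : 0 < δ)
        have := hκ' j
        exact Set.mem_Ioi.2 (by positivity)
    have h2 := (hO (κ j)).comp_tendsto ht
    have h3 : (fun δ : ℝ => (δ * (2 * κ j : ℝ)⁻¹) ^ (2 * m + 3)) =O[𝓝[>] 0]
        fun δ => δ ^ (2 * m + 3) := by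
      simp only [mul_pow]
      simpa [mul_comm] using (isBigO_refl (fun δ : ℝ => δ ^ (2 * m + 3)) (𝓝[>] 0)).const_mul_left
        ((2 * κ j : ℝ)⁻¹ ^ (2 * m + 3))
    refine ((h2.trans h3).const_smul_left (α j)).congr_left fun δ => ?_
    have hk := (hκ' j).ne'
    have e1 : (κ j : ℝ) * (2 * (δ * (2 * κ j : ℝ)⁻¹)) = δ := by field_simp
    have e2 (x : ℝ) : x * (2 * (δ * (2 * κ j : ℝ)⁻¹)) = x * δ / κ j := by field_simp
    simp only [Function.comp_apply, Pi.smul_apply, e1]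
    simp only [e2]
  refine (IsBigO.sum fun j (_ : j ∈ Finset.univ) => h1 j).congr_left fun δ => ?_
  simp only [Finset.sum_apply, smul_sub, Finset.sum_sub_distrib, Finset.smul_sum]
  congr 1
  rw [Finset.sum_comm]
  have h4 (r : ℕ) : ∑ j, α j • (δ * (2 * κ j : ℝ)⁻¹) ^ (2 * r) • e r (t + δ) =
      (δ ^ (2 * r) * ∑ j, α j * ((2 * κ j : ℝ)⁻¹) ^ (2 * r)) • e r (t + δ) := by
    rw [Finset.mul_sum, Finset.sum_smul]
    exact Finset.sum_congr rfl fun j _ => by rw [smul_smul, mul_pow]; congr 1; ring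
  simp only [h4]
  rw [Finset.sum_range_succ', Finset.sum_eq_zero fun r hr' => ?_, zero_add, he0]
  · simp [h0]
  · rw [hr (r + 1) (by omega) (by have := Finset.mem_range.1 hr'; omega), mul_zero, zero_smul]

end SplitStep

/-! ### Analytic continuation in a parameter. -/

/-- A vanishing order in the first variable, at all real values of a holomorphic parameter, holds
at all complex values. -/
theorem isBigO_of_isBigO_real_parameter {E : Type*} [NormedAddCommGroup E] [NormedSpace ℂ E]
    [CompleteSpace E] {F : ℂ × ℂ → E} (hF : ContDiff ℂ ∞ F) {n : ℕ}
    (h : ∀ z : ℝ, (fun δ : ℝ => F (z, δ)) =O[𝓝[>] 0] fun δ : ℝ => δ ^ n) (z : ℂ) :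
    (fun δ : ℝ => F (z, δ)) =O[𝓝[>] 0] fun δ : ℝ => δ ^ n := by
  obtain ⟨g, hg, hO⟩ := exists_taylor_snd n hF
  have hO' (z : ℂ) : (fun δ : ℝ => F (z, δ) - ∑ i ∈ Finset.range n, δ ^ i • g i z) =O[𝓝[>] 0]
      fun δ : ℝ => δ ^ n := by
    have hc : Continuous fun δ : ℝ => (z, (δ : ℂ)) := by fun_prop
    have ht : Tendsto (fun δ : ℝ => (z, (δ : ℂ))) (𝓝[>] 0) (𝓝 (z, 0)) := by
      simpa using (hc.tendsto 0).mono_left (nhdsWithin_le_nhds (s := Set.Ioi 0))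
    refine (((hO z).comp_tendsto ht).trans (isBigO_of_le _ fun δ => by simp)).congr_left
      fun δ => ?_
    simp only [Function.comp_apply, ← Complex.ofReal_pow, Complex.coe_smul]
  -- Each Taylor coefficient is entire in the parameter and zero on the reals, which accumulate at
  -- `0`; the identity theorem applies.
  have hz : ∀ i < n, g i = 0 := fun i hi => by
    have hreal (x : ℝ) : g i x = 0 := by
      refine eq_zero_of_sum_pow_smul_isBigO (n := n) (a := fun i => g i x) ?_ i hi
      exact ((h x).sub (hO' x)).congr_left fun δ => by abel
    have han : AnalyticOnNhd ℂ (g i) Set.univ :=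
      fun x _ => ((hg i).differentiable (by simp)).analyticAt x
    refine han.eq_of_frequently_eq analyticOnNhd_const (z₀ := 0) ?_
    have ht : Tendsto (fun x : ℝ => (x : ℂ)) (𝓝[>] 0) (𝓝[≠] 0) := by
      refine tendsto_nhdsWithin_iff.2 ⟨?_, ?_⟩
      · simpa using (Complex.continuous_ofReal.tendsto 0).mono_left nhdsWithin_le_nhds
      · filter_upwards [self_mem_nhdsWithin] with x (hx : 0 < x)
        simpa using hx.ne'
    exact ht.frequently (Eventually.frequently (Eventually.of_forall hreal))
  refine (hO' z).congr_left fun δ => ?_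
  rw [Finset.sum_eq_zero fun i hi => by rw [hz i (Finset.mem_range.1 hi)]; simp, sub_zero]

/-! ### The Taylor coefficients of `y cot y`. -/

section Cot

/-- The coefficients of `1 - y cot y` in powers of `y ^ 2`. -/
noncomputable def cotCoeff (n : ℕ) : ℝ :=
  ((if n = 1 then 1 else 0) +
    -- The term `i = 0` would call `cotCoeff n` itself; dropping it is harmless because `cotCoeff 0
    -- = 0`.
    ∑ i : Fin n, if _h : 0 < (i : ℕ) then cotCoeff i * cotCoeff (n - i) else 0) / (2 * n + 1)
decreasing_by all_goals omega

theorem cotCoeff_zero : cotCoeff 0 = 0 := by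
  rw [cotCoeff]; simp

/-- Coefficient form of the Riccati equation `2 x T' + T = x + T²` satisfied by `T = 1 - y cot y` in
the variable `x = y²`. -/
theorem cotCoeff_rec (n : ℕ) : (2 * n + 1) * cotCoeff n =
    (if n = 1 then 1 else 0) +
      ∑ p ∈ Finset.HasAntidiagonal.antidiagonal n, cotCoeff p.1 * cotCoeff p.2 := by
  have h : (2 * n + 1 : ℝ) ≠ 0 := by positivity
  rw [Finset.Nat.sum_antidiagonal_eq_sum_range_succ_mk, Finset.sum_range_succ, Nat.sub_self,
    cotCoeff_zero, mul_zero, add_zero, Finset.sum_range]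
  conv_lhs => rw [cotCoeff, mul_div_cancel₀ _ h]
  congr 1
  refine Finset.sum_congr rfl fun i _ => ?_
  split_ifs with hi
  · rfl
  · rw [Nat.eq_zero_of_not_pos hi, cotCoeff_zero, zero_mul]

theorem cotCoeff_nonneg (n : ℕ) : 0 ≤ cotCoeff n := by
  induction n using Nat.strong_induction_on with
  | _ n ih =>
    rw [cotCoeff]
    refine div_nonneg (add_nonneg (by split_ifs <;> simp) (Finset.sum_nonneg fun i _ => ?_))
      (by positivity)
    split_ifs with hi
    · exact mul_nonneg (ih _ i.2) (ih _ (by omega))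
    · rfl

/-- The recursion has only nonnegative terms, and the product with `cotCoeff 1` carries positivity
upwards. Nonvanishing is what lets every order condition be detected. -/
theorem cotCoeff_pos (n : ℕ) : 0 < cotCoeff (n + 1) := by
  have hsum (m : ℕ) : 0 ≤ ∑ p ∈ Finset.HasAntidiagonal.antidiagonal m, cotCoeff p.1 * cotCoeff p.2 :=
    Finset.sum_nonneg fun p _ => mul_nonneg (cotCoeff_nonneg _) (cotCoeff_nonneg _)
  have h1 : 0 < cotCoeff 1 := by
    have h := cotCoeff_rec 1
    have := hsum 1
    norm_num at h
    linarith
  induction n with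
  | zero => exact h1
  | succ n ih =>
    have h := cotCoeff_rec (n + 2)
    have h2 : cotCoeff 1 * cotCoeff (n + 1) ≤
        ∑ p ∈ Finset.HasAntidiagonal.antidiagonal (n + 2), cotCoeff p.1 * cotCoeff p.2 :=
      Finset.single_le_sum (f := fun p : ℕ × ℕ => cotCoeff p.1 * cotCoeff p.2)
        (fun p _ => mul_nonneg (cotCoeff_nonneg _) (cotCoeff_nonneg _))
        (a := (1, n + 1)) (by simp; ring)
    rw [if_neg (by omega), zero_add] at h
    have h3 := (mul_pos h1 ih).trans_le (h2.trans_eq h.symm)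
    exact pos_of_mul_pos_right h3 (by positivity)

open Polynomial in
/-- The truncated series of `1 - y cot y` satisfies its Riccati equation up to higher order. -/
theorem exists_cotPoly_riccati (n : ℕ) : ∃ P₁ W : ℝ[X],
    (∀ x : ℝ, x * P₁.eval x = ∑ i ∈ Finset.range (n + 1), x ^ i * cotCoeff i) ∧
    2 * derivative (X * P₁) + P₁ = X ^ n * W + 1 + X * P₁ * P₁ := by
  let T : PowerSeries ℝ := PowerSeries.mk cotCoeff
  let P : ℝ[X] := T.trunc (n + 1)
  have hc (i : ℕ) (hi : i ≤ n) : P.coeff i = cotCoeff i := by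
    simp [P, T, PowerSeries.coeff_trunc, Nat.lt_succ_of_le hi]
  obtain ⟨P₁, hP₁⟩ : X ∣ P := X_dvd_iff.2 (by rw [hc 0 (Nat.zero_le n), cotCoeff_zero])
  obtain ⟨W, hW⟩ : X ^ (n + 1) ∣ 2 * (X * derivative P) + P - X - P * P := by
    refine X_pow_dvd_iff.2 fun d hd => ?_
    have h1 : (P * P).coeff d = ∑ p ∈ Finset.HasAntidiagonal.antidiagonal d, cotCoeff p.1 * cotCoeff p.2 := by
      rw [coeff_mul]
      refine Finset.sum_congr rfl fun p hp => ?_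
      have := Finset.HasAntidiagonal.mem_antidiagonal.1 hp
      rw [hc _ (by omega), hc _ (by omega)]
    have h2 : (X * derivative P).coeff d = d * cotCoeff d := by
      cases d with
      | zero => simp
      | succ d => rw [coeff_X_mul, coeff_derivative, hc _ (by omega)]; push_cast; ring
    have h3 : (2 * (X * derivative P)).coeff d = 2 * (d * cotCoeff d) := by
      rw [← h2, ← coeff_ofNat_mul]
    rw [coeff_sub, coeff_sub, coeff_add, h1, h3, hc d (by omega), coeff_X]
    have := cotCoeff_rec d
    simp only [eq_comm (a := 1)]
    linarith
  refine ⟨P₁, W, fun x => ?_, ?_⟩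
  · have h : P.eval x = x * P₁.eval x := by rw [hP₁]; simp
    rw [← h, eval_eq_sum_range' (PowerSeries.natDegree_trunc_lt T n)]
    exact Finset.sum_congr rfl fun i hi => by
      rw [hc i (Nat.lt_succ_iff.1 (Finset.mem_range.1 hi)), mul_comm]
  · rw [hP₁] at hW
    refine mul_left_cancel₀ (X_ne_zero (R := ℝ)) ?_
    linear_combination hW

/-- The expansion of `y cot y`, multiplied by `sin y`. -/
theorem cot_expansion_aux (n : ℕ) :
    (fun y : ℝ => y * Real.cos y -
      (1 - ∑ i ∈ Finset.range (n + 1), (y ^ 2) ^ i * cotCoeff i) * Real.sin y)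
      =O[𝓝 0] fun y => y ^ (2 * n + 3) := by
  obtain ⟨P₁, W, hP, hW⟩ := exists_cotPoly_riccati n
  simp only [← hP]
  set Q : ℝ → ℝ := fun y => y * Real.cos y - (1 - y ^ 2 * P₁.eval (y ^ 2)) * Real.sin y with hQ
  have hQ' (y : ℝ) : HasDerivAt Q (y * P₁.eval (y ^ 2) * Q y +
      y * (y ^ 2) ^ n * W.eval (y ^ 2) * Real.sin y) y := by
    have h1 := ((Polynomial.X * P₁).hasDerivAt (y ^ 2)).comp y (hasDerivAt_pow 2 y)
    have h2 : HasDerivAt Q _ y := ((hasDerivAt_id y).mul (Real.hasDerivAt_cos y)).sub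
      (((hasDerivAt_const y (1 : ℝ)).sub (h1.congr_of_eventuallyEq
        (f₁ := fun y => y ^ 2 * P₁.eval (y ^ 2)) (Eventually.of_forall fun y => by simp))).mul
          (Real.hasDerivAt_sin y))
    refine h2.congr_deriv ?_
    have h3 := congrArg (Polynomial.eval (y ^ 2)) hW
    simp only [Polynomial.eval_add, Polynomial.eval_mul, Polynomial.eval_pow, Polynomial.eval_X,
      Polynomial.eval_one, Polynomial.eval_ofNat] at h3
    simp [hQ, -Polynomial.derivative_mul]
    linear_combination (y * Real.sin y) * h3
  have hcont : Continuous Q := continuous_iff_continuousAt.2 fun y => (hQ' y).continuousAt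
  have hpoly (p : Polynomial ℝ) : (fun y : ℝ => p.eval (y ^ 2)) =O[𝓝 0] fun _ => (1 : ℝ) :=
    ((by fun_prop : Continuous fun y : ℝ => p.eval (y ^ 2)).tendsto 0).isBigO_one ℝ
  have hsin : Real.sin =O[𝓝 0] fun y => y := by
    simpa using (Real.hasDerivAt_sin 0).isBigO_sub
  have hpow {k l : ℕ} (h : l ≤ k) : (fun y : ℝ => y ^ k) =O[𝓝 0] fun y => y ^ l :=
    IsBigO.of_bound 1 (by
      filter_upwards [Metric.ball_mem_nhds (0 : ℝ) one_pos] with y hy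
      rw [mem_ball_zero_iff] at hy
      rw [one_mul, norm_pow, norm_pow]
      exact pow_le_pow_of_le_one (norm_nonneg _) hy.le h)
  have hW' : (fun y : ℝ => y * (y ^ 2) ^ n * W.eval (y ^ 2) * Real.sin y) =O[𝓝 0]
      fun y => y ^ (2 * n + 2) := by
    refine (((isBigO_refl (fun y : ℝ => y * (y ^ 2) ^ n) (𝓝 0)).mul (hpoly W)).mul
      hsin).congr_right fun y => ?_
    ring
  -- Bootstrap: a bound `y^s` on `Q` bounds `Q'` by `y^s`, and integration gains one order, until
  -- the forcing term is the obstacle.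
  have key : ∀ s ≤ 2 * n + 3, Q =O[𝓝 0] fun y => y ^ s := by
    intro s
    induction s with
    | zero => intro _; simpa using (hcont.tendsto 0).isBigO_one ℝ
    | succ s ih =>
      intro hs
      have h1 : (fun y : ℝ => y * P₁.eval (y ^ 2) * Q y) =O[𝓝 0] fun y => y ^ (s + 1) := by
        refine (((isBigO_refl (fun y : ℝ => y) (𝓝 0)).mul (hpoly P₁)).mul
          (ih (by omega))).congr_right fun y => ?_
        ring
      have h2 := (h1.trans (hpow (Nat.le_succ s))).add (hW'.trans (hpow (l := s) (by omega)))
      have h3 := isBigO_snd_pow_succ (𝕜 := ℝ) (c := 0) (n := s) (Φ := fun p => Q p.2)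
        (Ψ := fun p => p.2 * P₁.eval (p.2 ^ 2) * Q p.2 +
          p.2 * (p.2 ^ 2) ^ n * W.eval (p.2 ^ 2) * Real.sin p.2)
        (fun p => hQ' p.2) (fun x => by simp [hQ])
        (h2.comp_tendsto (continuous_snd.tendsto ((0 : ℝ), (0 : ℝ))))
      exact h3.comp_tendsto ((Continuous.prodMk_right (0 : ℝ)).tendsto (0 : ℝ))
  exact key _ le_rfl

theorem cot_expansion (n : ℕ) :
    (fun y : ℝ => y * (Real.cos y / Real.sin y) -
      (1 - ∑ i ∈ Finset.range (n + 1), (y ^ 2) ^ i * cotCoeff i))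
      =O[𝓝[>] 0] fun y => (y ^ 2) ^ (n + 1) := by
  have hsin : (fun y : ℝ => (Real.sin y)⁻¹) =O[𝓝[>] 0] fun y => y⁻¹ := by
    refine IsBigO.of_bound 2 ?_
    filter_upwards [Ioo_mem_nhdsGT (zero_lt_one' ℝ)] with y hy
    have h1 := Real.sin_gt_sub_cube hy.1
    have h2 : y / 2 ≤ Real.sin y := by nlinarith [hy.1, hy.2, mul_pos hy.1 hy.1]
    have h3 : 0 < Real.sin y := by linarith [hy.1]
    rw [Real.norm_of_nonneg (inv_nonneg.2 h3.le), Real.norm_of_nonneg (inv_nonneg.2 hy.1.le),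
      ← div_eq_mul_inv, ← one_div, div_le_div_iff₀ h3 hy.1]
    linarith
  refine (((cot_expansion_aux n).mono nhdsWithin_le_nhds).mul hsin).congr' ?_ ?_
  · filter_upwards [Ioo_mem_nhdsGT Real.pi_pos] with y hy
    have := (Real.sin_pos_of_pos_of_lt_pi hy.1 hy.2).ne'
    field_simp
  · filter_upwards [self_mem_nhdsWithin] with y (hy : 0 < y)
    field_simp
    ring

theorem orderConditions_of_cot {M : ℕ} {α w : Fin M → ℝ} (hw : ∀ j, 0 < w j) {n : ℕ}
    (h : (fun δ : ℝ => 1 - ∑ j, α j * (w j * δ * (Real.cos (w j * δ) / Real.sin (w j * δ))))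
      =O[𝓝[>] 0] fun δ => (δ ^ 2) ^ (n + 1)) :
    ∑ j, α j = 1 ∧ ∀ r, 1 ≤ r → r ≤ n → ∑ j, α j * w j ^ (2 * r) = 0 := by
  have h1 (j : Fin M) : (fun δ : ℝ => w j * δ * (Real.cos (w j * δ) / Real.sin (w j * δ)) -
      (1 - ∑ i ∈ Finset.range (n + 1), ((w j * δ) ^ 2) ^ i * cotCoeff i))
      =O[𝓝[>] 0] fun δ => (δ ^ 2) ^ (n + 1) := by
    refine ((cot_expansion n).comp_tendsto
      (?_ : Tendsto (fun δ => w j * δ) (𝓝[>] 0) (𝓝[>] 0))).trans ?_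
    · refine tendsto_nhdsWithin_iff.2 ⟨?_, ?_⟩
      · have : Continuous fun δ : ℝ => w j * δ := by fun_prop
        simpa using (this.tendsto 0).mono_left (nhdsWithin_le_nhds (s := Set.Ioi 0))
      · filter_upwards [self_mem_nhdsWithin] with δ (hδ : 0 < δ)
        exact mul_pos (hw j) hδ
    · simp only [Function.comp_def, mul_pow]
      exact (isBigO_refl _ _).const_mul_left _
  · have h2 := h.add (IsBigO.sum fun j (_ : j ∈ Finset.univ) => (h1 j).const_mul_left (α j))
    -- Substituting `δ = √x` turns the expansion in `δ²` into one in consecutive powers of `x`.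
    have ht : Tendsto Real.sqrt (𝓝[>] 0) (𝓝[>] 0) := by
      refine tendsto_nhdsWithin_iff.2 ⟨?_, ?_⟩
      · simpa using (Real.continuous_sqrt.tendsto 0).mono_left nhdsWithin_le_nhds
      · filter_upwards [self_mem_nhdsWithin] with x hx
        exact Real.sqrt_pos.2 hx
    have h3 := h2.comp_tendsto ht
    have h4 := eq_zero_of_sum_pow_smul_isBigO (n := n + 1) (a := fun i => (if i = 0 then 1 else 0) -
      (if i = 0 then 1 else -cotCoeff i) * ∑ j, α j * w j ^ (2 * i)) (h3.congr' ?_ ?_)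
    · refine ⟨?_, fun r hr hrn => ?_⟩
      · have := h4 0 (Nat.succ_pos n)
        simp at this
        linarith
      · have := h4 r (by omega)
        obtain ⟨r, rfl⟩ := Nat.exists_eq_add_of_le' hr
        simpa [(cotCoeff_pos r).ne'] using this
    · filter_upwards [self_mem_nhdsWithin] with x (hx : 0 < x)
      have hs : Real.sqrt x ^ 2 = x := Real.sq_sqrt hx.le
      have h5 : ∑ j, α j * ∑ i ∈ Finset.range (n + 1), ((w j * Real.sqrt x) ^ 2) ^ i * cotCoeff i =
          ∑ i ∈ Finset.range (n + 1), x ^ i * (cotCoeff i * ∑ j, α j * w j ^ (2 * i)) := by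
        simp only [Finset.mul_sum]
        rw [Finset.sum_comm]
        refine Finset.sum_congr rfl fun i _ => Finset.sum_congr rfl fun j _ => ?_
        rw [mul_pow, hs, mul_pow, pow_mul]
        ring
      simp only [Function.comp_apply, Finset.sum_apply, mul_sub, Finset.sum_sub_distrib, mul_one,
        h5, smul_eq_mul]
      simp [Finset.sum_range_succ', cotCoeff_zero]
      ring
    · filter_upwards [self_mem_nhdsWithin] with x (hx : 0 < x)
      simp [Real.sq_sqrt hx.le]

end Cot

/-! ### Exponentials in the algebra of the matrix units `P = e₁₁`, `N = e₁₂`. -/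

section Triangular

variable {R : Type*} [NormedRing R] [NormedAlgebra ℂ R] [CompleteSpace R]

theorem exp_smul_of_idempotent {p : R} (hp : p * p = p) (c : ℂ) :
    NormedSpace.exp (c • p) = 1 + (Complex.exp c - 1) • p := by
  have hpow (n : ℕ) : p ^ (n + 1) = p := (show IsIdempotentElem p from hp).pow_succ_eq n
  have h1 := NormedSpace.exp_series_hasSum_exp' (𝕂 := ℂ) (c • p)
  have h2 : HasSum (fun n : ℕ => (n.factorial⁻¹ : ℂ) • c ^ n) (Complex.exp c) := by
    rw [Complex.exp_eq_exp_ℂ]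
    exact NormedSpace.exp_series_hasSum_exp' (𝕂 := ℂ) c
  have h3 := (h2.smul_const p).add (hasSum_ite_eq 0 (1 - p))
  have h4 : (fun n : ℕ => (n.factorial⁻¹ : ℂ) • (c • p) ^ n) = fun n : ℕ =>
      ((n.factorial⁻¹ : ℂ) • c ^ n) • p + if n = 0 then 1 - p else 0 := by
    funext n
    cases n with
    | zero => simp
    | succ n => simp [smul_pow, hpow, smul_smul]
  rw [h4] at h1
  rw [h1.unique h3]
  module

theorem exp_smul_of_mul_self_eq_zero {N : R} (hN : N * N = 0) (c : ℂ) :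
    NormedSpace.exp (c • N) = 1 + c • N := by
  have h1 := NormedSpace.exp_series_hasSum_exp' (𝕂 := ℂ) (c • N)
  have h2 : HasSum (fun n : ℕ => (n.factorial⁻¹ : ℂ) • (c • N) ^ n)
      (∑ n ∈ Finset.range 2, (n.factorial⁻¹ : ℂ) • (c • N) ^ n) := by
    refine hasSum_sum_of_ne_finset_zero fun n hn => ?_
    obtain ⟨k, rfl⟩ := Nat.exists_eq_add_of_le (not_lt.1 (fun h => hn (Finset.mem_range.2 h)))
    rw [pow_add, pow_two, smul_mul_smul_comm, hN]
    simp
  rw [h1.unique h2]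
  simp [Finset.sum_range_succ]

variable {P N : R} (hP : P * P = P) (hPN : P * N = N) (hNP : N * P = 0) (hN : N * N = 0)
include hP hPN hNP hN

theorem strang_triangular (c : ℂ) :
    NormedSpace.exp (c • N) * NormedSpace.exp (c • P) *
      (NormedSpace.exp (c • P) * NormedSpace.exp (c • N)) =
      1 + (Complex.exp (2 * c) - 1) • P + (c * (Complex.exp (2 * c) + 1)) • N := by
  rw [exp_smul_of_idempotent hP, exp_smul_of_mul_self_eq_zero hN, two_mul, Complex.exp_add]
  simp only [mul_add, add_mul, hP, hPN, hNP, hN, one_mul, mul_one,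
    mul_smul_comm, smul_mul_assoc, smul_smul, smul_add, zero_mul]
  module

omit [CompleteSpace R] in
theorem triangular_pow (u τ : ℂ) (n : ℕ) :
    (1 + (u - 1) • P + τ • N) ^ n =
      1 + (u ^ n - 1) • P + (τ * ∑ l ∈ Finset.range n, u ^ l) • N := by
  induction n with
  | zero => simp
  | succ n ih =>
    rw [pow_succ, ih, Finset.sum_range_succ]
    simp only [mul_add, add_mul, hP, hPN, hNP, hN, one_mul, mul_one,
      smul_zero, mul_smul_comm, smul_mul_assoc, smul_smul, smul_add]
    module

/-- `N + P` is again idempotent. -/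
theorem exp_smul_add_triangular (c : ℂ) :
    NormedSpace.exp (c • (N + P)) = 1 + (Complex.exp c - 1) • (N + P) :=
  exp_smul_of_idempotent (by simp [mul_add, add_mul, hP, hPN, hNP, hN]) c

end Triangular

/-- The off-diagonal entry of the powers of a triangular Strang step is `y cot y`. -/
theorem triangular_geom_sum {κ : ℕ} {y : ℝ} (hy : Real.sin y ≠ 0) :
    -Complex.I * y * (Complex.exp (2 * (-Complex.I * y)) + 1) *
      ∑ l ∈ Finset.range κ, Complex.exp (2 * (-Complex.I * y)) ^ l =
    (Complex.exp (κ * (2 * (-Complex.I * y))) - 1) * ((y * (Real.cos y / Real.sin y) : ℝ) : ℂ) := by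
  set E := Complex.exp (-Complex.I * y) with hE
  have hE' : E = Real.cos y - Real.sin y * Complex.I := by
    rw [hE, show -Complex.I * (y : ℂ) = ((-y : ℝ) : ℂ) * Complex.I by push_cast; ring,
      Complex.exp_mul_I, ← Complex.ofReal_cos, ← Complex.ofReal_sin, Real.cos_neg, Real.sin_neg]
    push_cast
    ring
  have hcs : (Real.cos y : ℂ) ^ 2 + (Real.sin y : ℂ) ^ 2 = 1 := by
    exact_mod_cast Real.cos_sq_add_sin_sq y
  have hs : (Real.sin y : ℂ) ≠ 0 := by exact_mod_cast hy
  have hE0 : E ≠ 0 := Complex.exp_ne_zero _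
  have hu : Complex.exp (2 * (-Complex.I * y)) = E ^ 2 := by
    rw [hE, ← Complex.exp_nat_mul]; norm_num
  -- `E² + 1` and `E² - 1` are `2 cos y` and `-2i sin y` times the same `E`, so their quotient
  -- yields the cotangent.
  have hadd : E ^ 2 + 1 = 2 * Real.cos y * E := by
    rw [hE']; linear_combination (Real.sin y : ℂ) ^ 2 * Complex.I_sq - hcs
  have hsub : E ^ 2 - 1 = -(2 * Complex.I * Real.sin y) * E := by
    rw [hE']; linear_combination (- (Real.sin y : ℂ) ^ 2) * Complex.I_sq + hcs
  have hne : E ^ 2 - 1 ≠ 0 := by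
    rw [hsub]
    simp [hs, hE0, -Complex.ofReal_sin]
  rw [Complex.exp_nat_mul, hu, hadd, geom_sum_eq (sub_ne_zero.1 hne)]
  push_cast
  rw [hsub]
  have hI := Complex.I_ne_zero
  simp only [← Complex.ofReal_cos, ← Complex.ofReal_sin]
  field_simp

/-! ### From the time-independent formula to the cotangent estimate. -/

section Conditions

/-- The Strang step with a complex time step. -/
noncomputable def complexStrangStep {R : Type*} [NormedRing R] [NormedAlgebra ℂ R] {Λ : ℕ}
    (H : Fin Λ → R) (w : ℂ) : R :=
  prodAsc (fun k => NormedSpace.exp ((-Complex.I * (w / 2)) • H k)) *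
    prodDesc (fun k => NormedSpace.exp ((-Complex.I * (w / 2)) • H k))

theorem complexStrangStep_ofReal {ℋ : Type*} [NormedAddCommGroup ℋ] [InnerProductSpace ℂ ℋ]
    {Λ : ℕ} (H : Fin Λ → ℋ →L[ℂ] ℋ) (δ : ℝ) : complexStrangStep H δ = strangStep H δ := by
  simp [complexStrangStep, strangStep]

theorem contDiff_exp {R : Type*} [NormedRing R] [NormedAlgebra ℂ R] [CompleteSpace R] :
    ContDiff ℂ ∞ (NormedSpace.exp : R → R) :=
  contDiff_iff_contDiffAt.2 fun x => (NormedSpace.exp_analytic x).contDiffAt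

theorem contDiff_complexStrangStep {R : Type*} [NormedRing R] [NormedAlgebra ℂ R]
    [CompleteSpace R] {E : Type*} [NormedAddCommGroup E] [NormedSpace ℂ E] {Λ : ℕ}
    {H : Fin Λ → E → R} (hH : ∀ k, ContDiff ℂ ∞ (H k)) {w : E → ℂ} (hw : ContDiff ℂ ∞ w) :
    ContDiff ℂ ∞ fun x => complexStrangStep (fun k => H k x) (w x) := by
  have h (k) : ContDiff ℂ ∞ fun x => NormedSpace.exp ((-Complex.I * (w x / 2)) • H k x) :=
    contDiff_exp.comp ((contDiff_const.mul (hw.div_const 2)).smul (hH k))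
  exact (ContDiff.prodAsc h).mul (ContDiff.prodDesc h)

variable {ℋ : Type*} [NormedAddCommGroup ℋ] [InnerProductSpace ℂ ℋ] [FiniteDimensional ℂ ℋ]

/-- The formula for a family of Hamiltonians, symmetric at real parameters and holomorphic in the
parameter, extends to complex parameters. -/
theorem TimeIndependentMPF.complex_parameter {Λ M m : ℕ} {α : Fin M → ℝ} {κ : Fin M → ℕ}
    (h : TimeIndependentMPF ℋ Λ α κ m) {H : Fin Λ → ℂ → ℋ →L[ℂ] ℋ}
    (hH : ∀ k, ContDiff ℂ ∞ (H k))
    (hsymm : ∀ k (x : ℝ), (H k x : ℋ →ₗ[ℂ] ℋ).IsSymmetric) (z : ℂ) :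
    (fun δ : ℝ => NormedSpace.exp ((-Complex.I * (δ : ℂ)) • ∑ k, H k z) -
        ∑ j, (α j : ℂ) • complexStrangStep (fun k => H k z) ((δ : ℂ) / κ j) ^ κ j)
      =O[𝓝[>] 0] fun δ : ℝ => δ ^ (2 * m + 1) := by
  have : CompleteSpace ℋ := FiniteDimensional.complete ℂ ℋ
  refine isBigO_of_isBigO_real_parameter (F := fun p : ℂ × ℂ =>
    NormedSpace.exp ((-Complex.I * p.2) • ∑ k, H k p.1) -
      ∑ j, (α j : ℂ) • complexStrangStep (fun k => H k p.1) (p.2 / κ j) ^ κ j) ?_ (fun x => ?_) z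
  · have hH' (k) : ContDiff ℂ ∞ fun p : ℂ × ℂ => H k p.1 := (hH k).comp contDiff_fst
    refine ContDiff.sub (contDiff_exp.comp ((contDiff_const.mul contDiff_snd).smul
      (ContDiff.sum fun k _ => hH' k))) (ContDiff.sum fun j _ =>
        ((contDiff_complexStrangStep hH' (contDiff_snd.div_const _)).pow _).const_smul (α j : ℂ))
  · refine (h (fun k => H k x) fun k => hsymm k x).congr_left fun δ => ?_
    congr 1
    refine Finset.sum_congr rfl fun j _ => ?_
    rw [← complexStrangStep_ofReal, Complex.coe_smul]
    push_cast
    rfl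

-- The formula is tested on `N`, `P` and zeros. The common factor `e^(-iδ) - 1` of the off-diagonal
-- entry is of order `δ`, which costs one power in the final bound.
open InnerProductSpace in
theorem TimeIndependentMPF.cot_isBigO {n M m : ℕ} {α : Fin M → ℝ} {κ : Fin M → ℕ}
    (hκ : ∀ j, 1 ≤ κ j) (h : TimeIndependentMPF ℋ (n + 2) α κ m) {v : Fin 2 → ℋ}
    (hv : Orthonormal ℂ v) :
    (fun δ : ℝ => 1 - ∑ j, α j * ((2 * κ j : ℝ)⁻¹ * δ *
      (Real.cos ((2 * κ j : ℝ)⁻¹ * δ) / Real.sin ((2 * κ j : ℝ)⁻¹ * δ))))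
      =O[𝓝[>] 0] fun δ => δ ^ (2 * m) := by
  have : CompleteSpace ℋ := FiniteDimensional.complete ℂ ℋ
  have h00 : inner ℂ (v 0) (v 0) = 1 := by simp [hv.1 0]
  have h01 : inner ℂ (v 0) (v 1) = 0 := hv.2 (by decide)
  have h10 : inner ℂ (v 1) (v 0) = 0 := hv.2 (by decide)
  set P : ℋ →L[ℂ] ℋ := rankOne ℂ (v 0) (v 0) with hPdef
  set N : ℋ →L[ℂ] ℋ := rankOne ℂ (v 0) (v 1) with hNdef
  set N' : ℋ →L[ℂ] ℋ := rankOne ℂ (v 1) (v 0) with hN'def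
  have hP : P * P = P := by
    rw [hPdef, ContinuousLinearMap.mul_def, rankOne_comp_rankOne, h00, one_smul]
  have hPN : P * N = N := by
    rw [hPdef, hNdef, ContinuousLinearMap.mul_def, rankOne_comp_rankOne, h00, one_smul]
  have hNP : N * P = 0 := by
    rw [hPdef, hNdef, ContinuousLinearMap.mul_def, rankOne_comp_rankOne, h10, zero_smul]
  have hN : N * N = 0 := by
    rw [hNdef, ContinuousLinearMap.mul_def, rankOne_comp_rankOne, h10, zero_smul]
  -- At real `z` the two coefficients are complex conjugates, so `B z` is symmetric; at `z = i` they
  -- are `1` and `0`, leaving `N`.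
  let B : ℂ → ℋ →L[ℂ] ℋ := fun z => ((1 - Complex.I * z) / 2) • N + ((1 + Complex.I * z) / 2) • N'
  let H : Fin (n + 2) → ℂ → ℋ →L[ℂ] ℋ := Fin.cons B (Fin.cons (fun _ => P) fun _ _ => 0)
  have hBI : B Complex.I = N := by
    simp only [B, Complex.I_mul_I]
    norm_num
  have hsm (k) : ContDiff ℂ ∞ (H k) := by
    refine Fin.cases ?_ (fun k => Fin.cases ?_ (fun k => ?_) k) k
    · simp only [H, Fin.cons_zero, B]
      fun_prop
    · exact contDiff_const
    · exact contDiff_const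
  have hsymm (k) (x : ℝ) : (H k x : ℋ →ₗ[ℂ] ℋ).IsSymmetric := by
    refine Fin.cases ?_ (fun k => Fin.cases ?_ (fun k => ?_) k) k
    · intro a b
      have e0 := inner_conj_symm (𝕜 := ℂ) a (v 0)
      have e1 := inner_conj_symm (𝕜 := ℂ) a (v 1)
      simp only [H, B, N, N', Fin.cons_zero, ContinuousLinearMap.coe_coe,
        add_apply, smul_apply, rankOne_apply,
        inner_add_left, inner_add_right, inner_smul_left, inner_smul_right, ← e0, ← e1, map_div₀,
        map_add, map_sub, map_mul, map_one, Complex.conj_I, Complex.conj_ofReal, map_ofNat]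
      ring
    · exact isSymmetric_rankOne_self _
    · intro a b
      simp [H]
  have h1 := h.complex_parameter hsm hsymm Complex.I
  have hH0 : H 0 Complex.I = N := hBI
  have hstep (w : ℂ) : complexStrangStep (fun k => H k Complex.I) w =
      1 + (Complex.exp (2 * (-Complex.I * (w / 2))) - 1) • P +
        (-Complex.I * (w / 2) * (Complex.exp (2 * (-Complex.I * (w / 2))) + 1)) • N := by
    rw [← strang_triangular hP hPN hNP hN, complexStrangStep]
    simp only [prodAsc_succ, prodDesc_succ, hH0]
    simp [H, prodAsc_one, prodDesc_one]
  have hsum : ∑ k, H k Complex.I = N + P := by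
    rw [Fin.sum_univ_succ, Fin.sum_univ_succ, hH0]
    simp [H]
  have h2 : (fun δ : ℝ => (Complex.exp (-Complex.I * δ) - 1) *
      ((1 - ∑ j, α j * ((2 * κ j : ℝ)⁻¹ * δ * (Real.cos ((2 * κ j : ℝ)⁻¹ * δ) /
        Real.sin ((2 * κ j : ℝ)⁻¹ * δ))) : ℝ) : ℂ)) =O[𝓝[>] 0] fun δ : ℝ => δ ^ (2 * m + 1) := by
    -- The `v 0`, `v 1` matrix element isolates the coefficient of `N`.
    have h3 : (fun δ : ℝ => inner ℂ (v 0) ((NormedSpace.exp ((-Complex.I * (δ : ℂ)) •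
        ∑ k, H k Complex.I) - ∑ j, (α j : ℂ) • complexStrangStep (fun k => H k Complex.I)
          ((δ : ℂ) / κ j) ^ κ j) (v 1))) =O[𝓝[>] 0] fun δ : ℝ => δ ^ (2 * m + 1) := by
      refine IsBigO.trans (isBigO_of_le _ fun δ => ?_) h1
      refine (norm_inner_le_norm _ _).trans ?_
      rw [hv.1 0, one_mul]
      exact (ContinuousLinearMap.le_opNorm _ _).trans (by rw [hv.1 1, mul_one])
    refine h3.congr' ?_ EventuallyEq.rfl
    have hsin : ∀ᶠ δ : ℝ in 𝓝[>] 0, ∀ j, Real.sin ((2 * κ j : ℝ)⁻¹ * δ) ≠ 0 := by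
      filter_upwards [Ioo_mem_nhdsGT Real.pi_pos] with δ hδ j
      have hj : (1 : ℝ) ≤ κ j := by exact_mod_cast hκ j
      have hj' : (2 * κ j : ℝ)⁻¹ ≤ 1 := inv_le_one_of_one_le₀ (by linarith)
      refine (Real.sin_pos_of_pos_of_lt_pi (mul_pos (by positivity) hδ.1) ?_).ne'
      exact (mul_le_of_le_one_left hδ.1.le hj').trans_lt hδ.2
    filter_upwards [hsin] with δ hδ
    have e1 (j : Fin M) : (δ : ℂ) / κ j / 2 = (((2 * κ j : ℝ)⁻¹ * δ : ℝ) : ℂ) := by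
      push_cast
      rw [mul_inv, div_div, div_eq_mul_inv, mul_inv]
      ring
    have e2 (j : Fin M) : Complex.exp (κ j * (2 * (-Complex.I * (((2 * κ j : ℝ)⁻¹ * δ : ℝ) : ℂ)))) =
        Complex.exp (-Complex.I * δ) := by
      have hj : (κ j : ℂ) ≠ 0 := by exact_mod_cast (Nat.one_le_iff_ne_zero.1 (hκ j))
      congr 1
      push_cast
      field_simp
    simp only [hsum, exp_smul_add_triangular hP hPN hNP hN, hstep,
      triangular_pow hP hPN hNP hN, e1, triangular_geom_sum (hδ _), e2]
    simp [hPdef, hNdef, h01, hv.1 0, hv.1 1]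
    rw [mul_sub, mul_one, Finset.mul_sum]
    congr 1
    exact Finset.sum_congr rfl fun j _ => by ring
  -- The derivative `-i` at `0` is nonzero, so `e^(-iδ) - 1` can be divided out.
  have h4 : (fun δ : ℝ => δ) =O[𝓝[>] 0] fun δ : ℝ => Complex.exp (-Complex.I * δ) - 1 := by
    have hd : HasDerivAt (fun δ : ℝ => Complex.exp (-Complex.I * δ)) (-Complex.I) 0 := by
      have := ((Complex.ofRealCLM.hasDerivAt (x := 0)).const_mul (-Complex.I)).cexp
      simpa using this
    have ht : Tendsto (fun δ : ℝ => (δ, (0 : ℝ))) (𝓝[>] 0) (𝓝 0 ×ˢ pure 0) :=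
      (tendsto_id.mono_left nhdsWithin_le_nhds).prodMk tendsto_const_pure
    have := (HasDerivAtFilter.isTheta_sub hd (by simp)).isBigO_symm.comp_tendsto ht
    simpa [Function.comp_def] using this
  have h5 := (h4.mul (isBigO_refl (fun δ : ℝ => ((1 - ∑ j, α j * ((2 * κ j : ℝ)⁻¹ * δ *
    (Real.cos ((2 * κ j : ℝ)⁻¹ * δ) / Real.sin ((2 * κ j : ℝ)⁻¹ * δ))) : ℝ) : ℂ))
      (𝓝[>] 0)).norm_left).trans h2
  have h6 := (isBigO_refl (fun δ : ℝ => δ⁻¹) (𝓝[>] 0)).mul h5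
  refine (h6.congr' ?_ ?_).of_norm_left
  · filter_upwards [self_mem_nhdsWithin] with δ (hδ : 0 < δ)
    rw [inv_mul_cancel_left₀ hδ.ne', Complex.norm_real]
  · filter_upwards [self_mem_nhdsWithin] with δ (hδ : 0 < δ)
    rw [pow_succ', inv_mul_cancel_left₀ hδ.ne']

end Conditions

/-! ### Degenerate cases in which the splitting step is exact. -/

section Exact

variable {R : Type*} [NormedRing R] [NormedAlgebra ℝ R] [CompleteSpace R]

theorem timeOrderedExp_zero (s t : ℝ) : timeOrderedExp (fun _ => (0 : R)) s t = 1 := by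
  simpa using timeOrderedExp_mul_eq (R := R) (A := fun _ => 0) continuous_const (f := fun _ => 1)
    (fun t => by simpa using hasDerivAt_const t (1 : R)) s t

/-- When everything commutes, the product of the propagators solves the equation of the sum. -/
theorem timeOrderedExp_add (hR : ∀ a b : R, a * b = b * a) {A B : ℝ → R} (hA : Continuous A)
    (hB : Continuous B) (s t : ℝ) :
    timeOrderedExp (fun r => A r + B r) s t = timeOrderedExp A s t * timeOrderedExp B s t := by
  have := timeOrderedExp_mul_eq (A := fun r => A r + B r) (hA.add hB)
    (f := fun t => timeOrderedExp A s t * timeOrderedExp B s t) (fun t => by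
      refine ((timeOrderedExp_hasDerivAt hA s t).mul
        (timeOrderedExp_hasDerivAt hB s t)).congr_deriv ?_
      rw [add_mul, mul_assoc, ← mul_assoc _ (B t), hR _ (B t), mul_assoc]) s t
  simpa [timeOrderedExp_self] using this

theorem prodAsc_timeOrderedExp (hR : ∀ a b : R, a * b = b * a) {Λ : ℕ} {A : Fin Λ → ℝ → R}
    (hA : ∀ k, Continuous (A k)) (s t : ℝ) :
    (prodAsc fun k => timeOrderedExp (A k) s t) = timeOrderedExp (fun r => ∑ k, A k r) s t := by
  induction Λ with
  | zero => simp [prodAsc_zero, timeOrderedExp_zero]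
  | succ n ih =>
    simp only [Fin.sum_univ_succ]
    rw [prodAsc_succ, ih fun k => hA k.succ, timeOrderedExp_add hR (hA 0)
      (continuous_finsetSum _ fun k _ => hA k.succ)]

theorem prodDesc_timeOrderedExp (hR : ∀ a b : R, a * b = b * a) {Λ : ℕ} {A : Fin Λ → ℝ → R}
    (hA : ∀ k, Continuous (A k)) (s t : ℝ) :
    (prodDesc fun k => timeOrderedExp (A k) s t) = timeOrderedExp (fun r => ∑ k, A k r) s t := by
  induction Λ with
  | zero => simp [prodDesc_zero, timeOrderedExp_zero]
  | succ n ih =>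
    simp only [Fin.sum_univ_succ]
    rw [prodDesc_succ, ih fun k => hA k.succ, hR, timeOrderedExp_add hR (hA 0)
      (continuous_finsetSum _ fun k _ => hA k.succ)]

theorem splitStep_of_commute (hR : ∀ a b : R, a * b = b * a) {Λ : ℕ} {A : Fin Λ → ℝ → R}
    (hA : ∀ k, Continuous (A k)) (t s : ℝ) :
    splitStep A t s = timeOrderedExp (fun r => ∑ k, A k r) s t := by
  rw [splitStep, prodAsc_timeOrderedExp hR hA, prodDesc_timeOrderedExp hR hA,
    timeOrderedExp_mul (continuous_finsetSum _ fun k _ => hA k)]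

theorem splitStep_of_le_one {Λ : ℕ} (hΛ : Λ ≤ 1) {A : Fin Λ → ℝ → R}
    (hA : ∀ k, Continuous (A k)) (t s : ℝ) :
    splitStep A t s = timeOrderedExp (fun r => ∑ k, A k r) s t := by
  interval_cases Λ
  · simp [splitStep, prodAsc_zero, prodDesc_zero, timeOrderedExp_zero]
  · simp [splitStep, prodAsc_succ, prodDesc_succ, prodAsc_zero, prodDesc_zero,
      timeOrderedExp_mul (hA 0)]

theorem multiProduct_eq_of_exact {Λ : ℕ} {A : Fin Λ → ℝ → R} (hA : ∀ k, Continuous (A k))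
    (h : ∀ t s, splitStep A t s = timeOrderedExp (fun r => ∑ k, A k r) s t) {M : ℕ}
    {α : Fin M → ℝ} {κ : Fin M → ℕ} (hκ : ∀ j, 1 ≤ κ j) (hα : ∑ j, α j = 1) (t δ : ℝ) :
    (∑ j, α j • prodDesc fun l : Fin (κ j) =>
      splitStep A (t + ((l : ℕ) + 1 : ℝ) * δ / (κ j : ℝ)) (t + (l : ℕ) * δ / (κ j : ℝ))) =
      timeOrderedExp (fun r => ∑ k, A k r) t (t + δ) := by
  have hS : Continuous fun r => ∑ k, A k r := continuous_finsetSum _ fun k _ => hA k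
  have key (c : ℝ) (n : ℕ) : (prodDesc fun l : Fin n =>
      splitStep A (t + ((l : ℕ) + 1 : ℝ) * δ / c) (t + (l : ℕ) * δ / c)) =
      timeOrderedExp (fun r => ∑ k, A k r) t (t + n * δ / c) := by
    induction n with
    | zero => simp [prodDesc_zero, timeOrderedExp_self]
    | succ n ih =>
      rw [prodDesc_castSucc]
      simp only [Fin.val_last, Fin.val_castSucc]
      rw [ih, h, timeOrderedExp_mul hS]
      push_cast
      rfl
  have hj (j) : (κ j : ℝ) * δ / κ j = δ :=
    mul_div_cancel_left₀ δ (by exact_mod_cast Nat.one_le_iff_ne_zero.1 (hκ j))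
  simp only [key, hj]
  rw [← Finset.sum_smul, hα, one_smul]

end Exact

/-! ### Order conditions and the final case analysis. -/

section MultiProduct

variable {ℋ : Type*} [NormedAddCommGroup ℋ] [InnerProductSpace ℂ ℋ]

/-- For zero Hamiltonians every exponential is `1`, so the constant `1 - ∑ α_j` must be
`O(δ^(2m+1))`, hence zero. -/
theorem TimeIndependentMPF.sum_eq_one [Nontrivial ℋ] {Λ M m : ℕ} {α : Fin M → ℝ}
    {κ : Fin M → ℕ} (h : TimeIndependentMPF ℋ Λ α κ m) : ∑ j, α j = 1 := by
  have h1 := h (fun _ => 0) fun k a b => by simp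
  have h2 := eq_zero_of_sum_pow_smul_isBigO (n := 2 * m + 1)
    (a := fun i => if i = 0 then (1 - ∑ j, α j) • (1 : ℋ →L[ℂ] ℋ) else 0)
    (h1.congr_left fun δ => ?_) 0 (Nat.succ_pos _)
  · simp only [if_true, smul_eq_zero, one_ne_zero, or_false] at h2
    linarith
  · simp [strangStep, NormedSpace.exp_zero, prodAsc_one, prodDesc_one, sub_smul, Finset.sum_smul]

theorem commute_of_finrank_le_one [FiniteDimensional ℂ ℋ] (h : Module.finrank ℂ ℋ ≤ 1)
    (a b : ℋ →L[ℂ] ℋ) : a * b = b * a := by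
  obtain ⟨v, hv⟩ := finrank_le_one_iff.1 h
  obtain ⟨x, hx⟩ := hv (a v)
  obtain ⟨y, hy⟩ := hv (b v)
  ext w
  obtain ⟨c, rfl⟩ := hv w
  simp [← hx, ← hy, smul_comm x y]

/-- On a space of dimension at least two, with at least two terms, the time-independent formula
forces the order conditions. -/
theorem TimeIndependentMPF.orderConditions [FiniteDimensional ℂ ℋ] {n M m : ℕ} {α : Fin M → ℝ}
    {κ : Fin M → ℕ} (hκ : ∀ j, 1 ≤ κ j) (h : TimeIndependentMPF ℋ (n + 2) α κ (m + 1))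
    (hd : 2 ≤ Module.finrank ℂ ℋ) :
    ∑ j, α j = 1 ∧ ∀ r, 1 ≤ r → r ≤ m → ∑ j, α j * ((2 * κ j : ℝ)⁻¹) ^ (2 * r) = 0 := by
  have hv := (stdOrthonormalBasis ℂ ℋ).orthonormal.comp (Fin.castLE hd) (Fin.castLE_injective hd)
  have hw (j) : (0 : ℝ) < (2 * κ j : ℝ)⁻¹ := by
    have : (0 : ℝ) < κ j := by exact_mod_cast hκ j
    positivity
  -- Order `2(m+1)` becomes `(δ²)^(m+1)`, which determines the coefficients only up to `r = m`.
  exact orderConditions_of_cot hw ((h.cot_isBigO hκ hv).congr_right fun δ => pow_mul _ _ _)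

end MultiProduct

theorem mainTheorem4 {ℋ : Type*} [NormedAddCommGroup ℋ] [InnerProductSpace ℂ ℋ]
    [FiniteDimensional ℂ ℋ] {Λ : ℕ} (H : Fin Λ → ℝ → ℋ →L[ℂ] ℋ)
    (hH : ∀ k, ContDiff ℝ ∞ (H k))
    {M : ℕ} (α : Fin M → ℝ) (κ : Fin M → ℕ) (hκ : ∀ j, 1 ≤ κ j) (m : ℕ)
    (hMPF : TimeIndependentMPF ℋ Λ α κ m) (t : ℝ) :
    (fun δ : ℝ => evolution (fun r => ∑ k, H k r) (t + δ) t -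
        ∑ j, α j • prodDesc (fun l : Fin (κ j) =>
          hdrStep H (t + ((l : ℕ) + 1 : ℝ) * δ / (κ j : ℝ)) (t + (l : ℕ) * δ / (κ j : ℝ))))
      =O[𝓝[>] 0] fun δ : ℝ => δ ^ (2 * m + 1) := by
  have : CompleteSpace ℋ := FiniteDimensional.complete ℂ ℋ
  rcases subsingleton_or_nontrivial ℋ with hℋ | hℋ
  · exact (isBigO_zero _ _).congr_left fun δ => Subsingleton.elim _ _
  let A : Fin Λ → ℝ → ℋ →L[ℂ] ℋ := fun k r => (-Complex.I) • H k r
  have hA (k) : ContDiff ℝ ∞ (A k) := (hH k).const_smul _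
  have hstep : hdrStep H = splitStep A := rfl
  have hev (δ : ℝ) : evolution (fun r => ∑ k, H k r) (t + δ) t =
      timeOrderedExp (fun r => ∑ k, A k r) t (t + δ) := by
    simp only [evolution, A, Finset.smul_sum]
  simp only [hev, hstep]
  have hα := hMPF.sum_eq_one
  -- Here the hypothesis yields no more than `∑ α_j = 1`, but exactness of the steps makes that
  -- sufficient.
  by_cases hex : Λ ≤ 1 ∨ Module.finrank ℂ ℋ ≤ 1
  · have hc (k) := (hA k).continuous
    have hexact : ∀ t s, splitStep A t s = timeOrderedExp (fun r => ∑ k, A k r) s t := by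
      rcases hex with h | h
      · exact splitStep_of_le_one h hc
      · exact splitStep_of_commute (commute_of_finrank_le_one h) hc
    refine (isBigO_zero _ _).congr_left fun δ => ?_
    rw [multiProduct_eq_of_exact hc hexact hκ hα, sub_self]
  · push Not at hex
    rcases m with _ | m
    -- For `m = 0` the range of order conditions is empty, and symmetry alone gives `O(δ³)`, more
    -- than the required `O(δ)`.
    · exact (isBigO_multiProduct_of_orderConditions hA hκ 0 hα (by omega) t).trans
        (isBigO_pow_of_le (by omega))
    · obtain ⟨n, rfl⟩ := Nat.exists_eq_add_of_le' (Nat.succ_le_of_lt hex.1)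
      exact isBigO_multiProduct_of_orderConditions hA hκ m hα
        (hMPF.orderConditions hκ (Nat.succ_le_of_lt hex.2)).2 t
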